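/- All structures below are countably infinite with underlying set $\omega=\mathbb N$. Let $X_{\mathrm{Gr}}$ be the standard Borel space of (simple, undirected) graphs on $\omega$. A plane is regarded as a geometric (i.e. atomistic and semimodular) lattice of length $3$ in the signature $\{0,1,\vee,\wedge\}$; its points are the atoms and its lines are the coatoms. It is projective if any two distinct lines meet in a point, and non-Desarguesian if Desargues' theorem fails in it. Let $X_{\mathrm{ppl}}$ be the standard Borel space of non-Desarguesian projective planes with underlying set $\omega$. Embeddings of graphs are embeddings of structures (isomorphisms onto induced subgraphs); embeddings of planes are injective maps preserving $0,1,\vee,\wedge$. We write $\cong$ for isomorphism and $\sqsubseteq$ for embeddability. **Theorem.** There is a construction $\Gamma\mapsto P^*_\Gamma$ which is a Borel map $X_{\mathrm{Gr}}\to X_{\mathrm{ppl}}$ such that for all $\Gamma,\Gamma_1,\Gamma_2\in X_{\mathrm{Gr}}$: 1. $\Gamma_1\cong\Gamma_2$ if and only if $P^*_{\Gamma_1}\cong P^*_{\Gamma_2}$; 2. $\mathrm{Aut}(\Gamma)\cong \mathrm{Aut}(P^*_\Gamma)$ (as groups); 3. $\Gamma_1\sqsubseteq\Gamma_2$ if and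 only if $P^*_{\Gamma_1}\sqsubseteq P^*_{\Gamma_2}$. -/

import Mathlib

section GeometricLattices

variable (L : Type*) [Lattice L] [BoundedOrder L]

/-- A plane, regarded as a lattice: a geometric (atomistic, semimodular) lattice of length `3`,
i.e. one whose longest chains are of the form `⊥ < point < line < ⊤`. -/
structure IsPlane : Prop where
  atomistic : IsAtomistic L
  semimodular : IsUpperModularLattice L
  length_eq_three : Order.krullDim L = 3

/-- Every two distinct lines (coatoms) meet in a point (an atom). -/
def IsProjective : Prop :=
  ∀ l m : L, IsCoatom l → IsCoatom m → l ≠ m → IsAtom (l ⊓ m)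

variable {L}

/-- Three elements lie on a common line. -/
def LiesOnLine (x y z : L) : Prop :=
  ∃ l : L, IsCoatom l ∧ x ≤ l ∧ y ≤ l ∧ z ≤ l

/-- `a` and `b` are two triangles (of points), in perspective from the point `o`: corresponding
vertices are distinct from each other and from `o` and collinear with `o`, and the three lines
through `o` are distinct. -/
structure CentrallyPerspective (o : L) (a b : Fin 3 → L) : Prop where
  atom_center : IsAtom o
  atom_left : ∀ i, IsAtom (a i)
  atom_right : ∀ i, IsAtom (b i)
  triangle_left : ¬ LiesOnLine (a 0) (a 1) (a 2)
  triangle_right : ¬ LiesOnLine (b 0) (b 1) (b 2)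
  ne_left : ∀ i, a i ≠ o
  ne_right : ∀ i, b i ≠ o
  ne : ∀ i, a i ≠ b i
  collinear : ∀ i, LiesOnLine o (a i) (b i)
  lines_ne : ∀ i j, i ≠ j → o ⊔ a i ≠ o ⊔ a j

variable (L)

/-- Desargues' theorem: for two triangles in perspective from a point, the three intersections of
corresponding sides lie on a line. -/
def IsDesarguesian : Prop :=
  ∀ (o : L) (a b : Fin 3 → L), CentrallyPerspective o a b →
    LiesOnLine ((a 0 ⊔ a 1) ⊓ (b 0 ⊔ b 1)) ((a 0 ⊔ a 2) ⊓ (b 0 ⊔ b 2))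
      ((a 1 ⊔ a 2) ⊓ (b 1 ⊔ b 2))

end GeometricLattices

/-- The space of countable graphs: graphs with vertex set `ℕ`, with the Borel structure generated
by the sets `{Γ | Γ.Adj m n}` (the instance on `SimpleGraph ℕ` in Mathlib). -/
abbrev XGr : Type := SimpleGraph ℕ

/-- The space of countable non-Desarguesian projective planes: structures with underlying set `ℕ`
in the signature `{0, 1, ∨, ∧}` that are geometric lattices of length `3` corresponding to
non-Desarguesian projective planes. (The fields `lattice` and `bounded` have nothing to do with
the usual order on `ℕ`, which is only used as a set.) -/
structure XPpl : Type where
  lattice : Lattice ℕ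
  bounded : @BoundedOrder ℕ lattice.toLE
  isPlane : @IsPlane ℕ lattice bounded
  isProjective : @IsProjective ℕ lattice bounded
  not_isDesarguesian : ¬ @IsDesarguesian ℕ lattice bounded

namespace XPpl

/-- The underlying set `ℕ` of the structure `P`, as a type carrying the lattice of `P`. -/
def Carrier (_P : XPpl) : Type := ℕ

instance instLattice (P : XPpl) : Lattice P.Carrier := P.lattice

instance instBoundedOrder (P : XPpl) : BoundedOrder P.Carrier := P.bounded

/-- The code of a structure in the signature `{0, 1, ∨, ∧}` as a point of
`ℕ × ℕ × ℕ^(ℕ × ℕ) × ℕ^(ℕ × ℕ)`. -/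
def code (P : XPpl) : ℕ × ℕ × (ℕ × ℕ → ℕ) × (ℕ × ℕ → ℕ) :=
  (P.bounded.bot, P.bounded.top, fun p => P.lattice.sup p.1 p.2, fun p => P.lattice.inf p.1 p.2)

/-- The Borel structure on the space of planes is induced from the Borel structure of the Polish
space `ℕ × ℕ × ℕ^(ℕ × ℕ) × ℕ^(ℕ × ℕ)` of all structures in the signature `{0, 1, ∨, ∧}`. -/
instance instMeasurableSpace : MeasurableSpace XPpl :=
  MeasurableSpace.comap code inferInstance

/-- Embeddability of planes: there is an injective map preserving `0`, `1`, `∨` and `∧`. -/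
def Embeds (P Q : XPpl) : Prop :=
  ∃ φ : BoundedLatticeHom P.Carrier Q.Carrier, Function.Injective φ

end XPpl

/-! The graph is coded in a rigid partial plane, and the projective plane is the free completion of
this partial plane, viewed as a lattice of flats.

The partial plane `graphPlane Γ` is a grid. Each vertex supplies two indices. An ordered pair of
distinct indices is a cell, lying on a row, a column and the diagonal that it shares with the
transposed cell; all rows pass through `center`. Each diagonal carries one of three colour points.
Between indices of the first kind, colours 0 and 1 record adjacency and non-adjacency in `Γ`;
between a first and a second index they record whether the vertices agree; two second indices have
colour 2. The line `axis` contains `center` and the colours 0 and 1, which singles out colour 2. The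
second indices make all colours occur whatever the graph is, and prevent colours 0 and 1 from being
exchanged. Infinite lines, `center` and the colours can be recognized by incidence, so every
embedding of such partial planes comes from a graph embedding (`Emb.exists_graphEmb`).

The free completion adjoins a formal line to any two points without a common line, and dually,
forever; its elements are terms. In a finite configuration where every element has three neighbours,
a term of maximal size cannot be a formal join, because a join has only two neighbours of no larger
size. Each element of `graphPlane Γ` lies in such a configuration, so embeddings of the completed
planes map base elements to base elements (`Emb.exists_ofBase`) and are determined there
(`Emb.ext_base`). Conversely graph embeddings have closed image, hence extend (`graphEmb_isClosed`,
`freeMap`). With `Lat.exists_emb`, embeddings of graphs correspond functorially and bijectively to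
embeddings of lattices, which gives all three equivalences.

Desargues' theorem fails because freely adjoined intersection points are not collinear
(`not_isDesarguesian_free`). The map is Borel because all terms come from one countable set, on
which validity and incidence depend on `Γ` in a Borel way (`measurable_codedPlane`). -/

/-- A partial plane: points (`side = true`) and lines (`side = false`) with a symmetric incidence
relation, such that two distinct elements are incident with at most one common element. -/
structure PartialPlane (B : Type*) where
  side : B → Bool
  Adj : B → B → Prop
  symm : ∀ {x y}, Adj x y → Adj y x
  side_ne : ∀ {x y}, Adj x y → side x ≠ side y
  unique : ∀ {x y u v}, Adj u x → Adj u y → Adj v x → Adj v y → x = y ∨ u = v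

namespace PartialPlane

variable {B C D : Type*}

/-- A partial plane is a (thick enough) projective plane. -/
structure Complete (Q : PartialPlane B) : Prop where
  exists_adj : ∀ x y, Q.side x = Q.side y → ∃ u, Q.Adj u x ∧ Q.Adj u y
  two_adj : ∀ x, ∃ y z, y ≠ z ∧ Q.Adj x y ∧ Q.Adj x z
  exists_point : ∃ x, Q.side x = true

/-- Embeddings of partial planes preserve and reflect incidence. -/
structure Emb (Q : PartialPlane B) (R : PartialPlane C) where
  toFun : B → C
  injective : Function.Injective toFun
  side_eq : ∀ x, R.side (toFun x) = Q.side x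
  adj_iff : ∀ x y, R.Adj (toFun x) (toFun y) ↔ Q.Adj x y

theorem Emb.ext {Q : PartialPlane B} {R : PartialPlane C} {f g : Emb Q R}
    (h : ∀ x, f.toFun x = g.toFun x) : f = g := by
  cases f; cases g; congr; exact funext h

/-! ### The lattice of flats of a projective plane -/

/-- The elements of the lattice of flats of a plane. -/
inductive Lat (Q : PartialPlane B) : Type _
  | bot : Lat Q
  | el (x : B) : Lat Q
  | top : Lat Q

namespace Lat

variable {Q : PartialPlane B} {R : PartialPlane C} {S : PartialPlane D}

/-- The order on flats: a point lies below the lines it is incident with. -/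
protected def le : Lat Q → Lat Q → Prop
  | bot, _ => True
  | _, top => True
  | el x, el y => x = y ∨ (Q.side x = true ∧ Q.Adj x y)
  | top, _ => False
  | el _, bot => False

/-- The rank of a flat. -/
def rank : Lat Q → ℕ
  | bot => 0
  | el x => if Q.side x then 1 else 2
  | top => 3

instance : LE (Lat Q) := ⟨Lat.le⟩

theorem bot_le' (x : Lat Q) : bot ≤ x := by cases x <;> trivial

theorem le_top' (x : Lat Q) : x ≤ top := by cases x <;> trivial

theorem el_le_el {x y : B} :
    (el x : Lat Q) ≤ el y ↔ x = y ∨ (Q.side x = true ∧ Q.Adj x y) := Iff.rfl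

theorem side_of_adj {x y : B} (h : Q.Adj x y) (hx : Q.side x = true) : Q.side y = false := by
  have := Q.side_ne h
  rw [hx] at this
  simpa using this.symm

theorem side_of_adj' {x y : B} (h : Q.Adj x y) (hx : Q.side x = false) : Q.side y = true := by
  have := Q.side_ne h
  rw [hx] at this
  simpa using this.symm

instance : PartialOrder (Lat Q) where
  le_refl x := by cases x <;> simp [LE.le, Lat.le]
  le_trans x y z hxy hyz := by
    rcases x with _ | x | _
    · exact bot_le' z
    · rcases z with _ | z | _
      · rcases y with _ | y | _
        · exact hxy
        · exact hyz.elim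
        · exact hyz.elim
      · rcases y with _ | y | _
        · exact hxy.elim
        · rcases hxy with rfl | ⟨h1, h2⟩
          · exact hyz
          · rcases hyz with rfl | ⟨h3, h4⟩
            · exact Or.inr ⟨h1, h2⟩
            · simp [side_of_adj h2 h1] at h3
        · exact hyz.elim
      · exact le_top' _
    · rcases y with _ | y | _
      · exact hxy.elim
      · exact hxy.elim
      · exact hyz
  le_antisymm x y hxy hyx := by
    rcases x with _ | x | _ <;> rcases y with _ | y | _
    all_goals first | rfl | exact hxy.elim | exact hyx.elim | skip
    rcases hxy with rfl | ⟨h1, h2⟩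
    · rfl
    · rcases hyx with rfl | ⟨h3, h4⟩
      · rfl
      · simp [side_of_adj h2 h1] at h3

theorem rank_strictMono : StrictMono (rank : Lat Q → ℕ) := by
  intro x y h
  rcases h.le, h.ne with ⟨hle, hne⟩
  rcases x with _ | x | _ <;> rcases y with _ | y | _
  · exact (hne rfl).elim
  · simp only [rank]; split <;> omega
  · simp [rank]
  · exact hle.elim
  · rcases hle with rfl | ⟨h1, h2⟩
    · exact (hne rfl).elim
    · simp [rank, h1, side_of_adj h2 h1]
  · simp only [rank]; split <;> omega
  · exact hle.elim
  · exact hle.elim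
  · exact (hne rfl).elim

theorem isLUB_pair_of_le {x y : Lat Q} (h : x ≤ y) : IsLUB {x, y} y :=
  ⟨by rintro z (rfl | rfl); exacts [h, le_rfl], fun _ hz => hz (by simp)⟩

theorem isGLB_pair_of_le {x y : Lat Q} (h : x ≤ y) : IsGLB {x, y} x :=
  ⟨by rintro z (rfl | rfl); exacts [le_rfl, h], fun _ hz => hz (by simp)⟩

theorem isLUB_points {x y u : B} (hxy : x ≠ y) (hx : Q.side x = true) (hux : Q.Adj u x)
    (huy : Q.Adj u y) : IsLUB {(el x : Lat Q), el y} (el u) := by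
  have hu := side_of_adj (Q.symm hux) hx
  have hy := side_of_adj' huy hu
  refine ⟨?_, fun z hz => ?_⟩
  · rintro z (rfl | rfl)
    exacts [Or.inr ⟨hx, Q.symm hux⟩, Or.inr ⟨hy, Q.symm huy⟩]
  · have h1 : el x ≤ z := hz (by simp)
    have h2 : el y ≤ z := hz (by simp)
    rcases z with _ | z | _
    · exact h1.elim
    · left
      rcases h1 with rfl | ⟨-, h1⟩ <;> rcases h2 with rfl | ⟨-, h2⟩
      · exact (hxy rfl).elim
      · simp [side_of_adj h2 hy] at hx
      · simp [side_of_adj h1 hx] at hy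
      · exact (Q.unique hux huy (Q.symm h1) (Q.symm h2)).resolve_left hxy
    · exact le_top' _

theorem isGLB_lines {x y u : B} (hxy : x ≠ y) (hx : Q.side x = false) (hux : Q.Adj u x)
    (huy : Q.Adj u y) : IsGLB {(el x : Lat Q), el y} (el u) := by
  have hu := side_of_adj' (Q.symm hux) hx
  have hy := side_of_adj huy hu
  refine ⟨?_, fun z hz => ?_⟩
  · rintro z (rfl | rfl)
    exacts [Or.inr ⟨hu, hux⟩, Or.inr ⟨hu, huy⟩]
  · have h1 : z ≤ el x := hz (by simp)
    have h2 : z ≤ el y := hz (by simp)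
    rcases z with _ | z | _
    · exact bot_le' _
    · left
      rcases h1 with rfl | ⟨hz'', h1⟩ <;> rcases h2 with rfl | ⟨hz', h2⟩
      · exact (hxy rfl).elim
      · simp [hx] at hz'
      · rw [hy] at hz''; cases hz''
      · exact ((Q.unique hux huy h1 h2).resolve_left hxy).symm
    · exact h1.elim

/-- Only the line `y` itself and the top lie above `y`, so `x` may be a point off `y` or another
line. -/
theorem isLUB_top {x y : B} (hxy : ¬ (el x : Lat Q) ≤ el y) (hy : Q.side y = false) :
    IsLUB {(el x : Lat Q), el y} top := by
  refine ⟨fun z _ => le_top' z, fun z hz => ?_⟩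
  have h1 : el x ≤ z := hz (by simp)
  have h2 : el y ≤ z := hz (by simp)
  rcases z with _ | z | _
  · exact h1.elim
  · rcases h2 with rfl | ⟨h, -⟩
    · exact (hxy h1).elim
    · simp [hy] at h
  · exact le_rfl

theorem isGLB_bot {x y : B} (hxy : ¬ (el x : Lat Q) ≤ el y) (hyx : ¬ (el y : Lat Q) ≤ el x)
    (hx : Q.side x = true) : IsGLB {(el x : Lat Q), el y} bot := by
  refine ⟨fun z _ => bot_le' z, fun z hz => ?_⟩
  have h1 : z ≤ el x := hz (by simp)
  have h2 : z ≤ el y := hz (by simp)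
  rcases z with _ | z | _
  · exact le_rfl
  · rcases h1 with rfl | ⟨h, h'⟩
    · exact (hxy h2).elim
    · simp [side_of_adj h' h] at hx
  · exact h1.elim

theorem exists_isLUB (hQ : Q.Complete) (x y : Lat Q) : ∃ z, IsLUB {x, y} z := by
  by_cases hxy : x ≤ y
  · exact ⟨y, isLUB_pair_of_le hxy⟩
  by_cases hyx : y ≤ x
  · exact ⟨x, Set.pair_comm x y ▸ isLUB_pair_of_le hyx⟩
  rcases x with _ | x | _
  · exact (hxy (bot_le' _)).elim
  · rcases y with _ | y | _
    · exact (hyx (bot_le' _)).elim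
    · cases hx : Q.side x <;> cases hy : Q.side y
      · exact ⟨_, isLUB_top hxy hy⟩
      · exact ⟨_, Set.pair_comm (el y) (el x) ▸ isLUB_top hyx hx⟩
      · exact ⟨_, isLUB_top hxy hy⟩
      · obtain ⟨u, h1, h2⟩ := hQ.exists_adj x y (hx.trans hy.symm)
        exact ⟨_, isLUB_points (fun h => hxy (Or.inl h)) hx h1 h2⟩
    · exact (hxy (le_top' _)).elim
  · exact (hyx (le_top' _)).elim

theorem exists_isGLB (hQ : Q.Complete) (x y : Lat Q) : ∃ z, IsGLB {x, y} z := by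
  by_cases hxy : x ≤ y
  · exact ⟨x, isGLB_pair_of_le hxy⟩
  by_cases hyx : y ≤ x
  · exact ⟨y, Set.pair_comm x y ▸ isGLB_pair_of_le hyx⟩
  rcases x with _ | x | _
  · exact (hxy (bot_le' _)).elim
  · rcases y with _ | y | _
    · exact (hyx (bot_le' _)).elim
    · cases hx : Q.side x <;> cases hy : Q.side y
      · obtain ⟨u, h1, h2⟩ := hQ.exists_adj x y (hx.trans hy.symm)
        exact ⟨_, isGLB_lines (fun h => hxy (Or.inl h)) hx h1 h2⟩
      · exact ⟨_, Set.pair_comm (el y) (el x) ▸ isGLB_bot hyx hxy hy⟩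
      · exact ⟨_, isGLB_bot hxy hyx hx⟩
      · exact ⟨_, isGLB_bot hxy hyx hx⟩
    · exact (hxy (le_top' _)).elim
  · exact (hyx (le_top' _)).elim

/-- The lattice of flats of a projective plane. -/
noncomputable instance [hQ : Fact Q.Complete] : Lattice (Lat Q) where
  sup x y := (exists_isLUB hQ.out x y).choose
  inf x y := (exists_isGLB hQ.out x y).choose
  le_sup_left x y := (exists_isLUB hQ.out x y).choose_spec.1 (by simp)
  le_sup_right x y := (exists_isLUB hQ.out x y).choose_spec.1 (by simp)
  sup_le x y z hx hy := (exists_isLUB hQ.out x y).choose_spec.2 (by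
    rintro w (rfl | rfl); exacts [hx, hy])
  inf_le_left x y := (exists_isGLB hQ.out x y).choose_spec.1 (by simp)
  inf_le_right x y := (exists_isGLB hQ.out x y).choose_spec.1 (by simp)
  le_inf x y z hx hy := (exists_isGLB hQ.out y z).choose_spec.2 (by
    rintro w (rfl | rfl); exacts [hx, hy])

instance : BoundedOrder (Lat Q) where
  bot := bot
  bot_le := bot_le'
  top := top
  le_top := le_top'

theorem bot_def : (⊥ : Lat Q) = bot := rfl

theorem top_def : (⊤ : Lat Q) = top := rfl

section Lattice

variable [hQ : Fact Q.Complete]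

theorem sup_eq_of_isLUB {x y z : Lat Q} (h : IsLUB {x, y} z) : x ⊔ y = z :=
  isLUB_pair.unique h

theorem inf_eq_of_isGLB {x y z : Lat Q} (h : IsGLB {x, y} z) : x ⊓ y = z :=
  isGLB_pair.unique h

theorem sup_points {x y u : B} (hxy : x ≠ y) (hx : Q.side x = true) (hux : Q.Adj u x)
    (huy : Q.Adj u y) : (el x : Lat Q) ⊔ el y = el u :=
  sup_eq_of_isLUB (isLUB_points hxy hx hux huy)

theorem inf_lines {x y u : B} (hxy : x ≠ y) (hx : Q.side x = false) (hux : Q.Adj u x)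
    (huy : Q.Adj u y) : (el x : Lat Q) ⊓ el y = el u :=
  inf_eq_of_isGLB (isGLB_lines hxy hx hux huy)

end Lattice

theorem rank_el_of_point {x : B} (hx : Q.side x = true) : rank (el x : Lat Q) = 1 := by
  simp [rank, hx]

theorem rank_el_of_line {x : B} (hx : Q.side x = false) : rank (el x : Lat Q) = 2 := by
  simp [rank, hx]

theorem isAtom_el {x : B} (hx : Q.side x = true) : IsAtom (el x : Lat Q) := by
  refine ⟨fun h => by simp [bot_def] at h, fun y hy => ?_⟩
  have := rank_strictMono hy
  rw [rank_el_of_point hx] at this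
  rcases y with _ | y | _
  · rfl
  · simp only [rank] at this; split at this <;> omega
  · simp [rank] at this

theorem isCoatom_el {x : B} (hx : Q.side x = false) : IsCoatom (el x : Lat Q) := by
  refine ⟨fun h => by simp [top_def] at h, fun y hy => ?_⟩
  have := rank_strictMono hy
  rw [rank_el_of_line hx] at this
  rcases y with _ | y | _
  · simp [rank] at this
  · simp only [rank] at this; split at this <;> omega
  · rfl

theorem exists_el_between (hQ : Q.Complete) (x : B) (hx : Q.side x = true) :
    ∃ y, Q.side y = false ∧ (el x : Lat Q) < el y := by
  obtain ⟨y, -, -, h, -⟩ := hQ.two_adj x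
  refine ⟨y, side_of_adj h hx, lt_of_le_of_ne (Or.inr ⟨hx, h⟩) ?_⟩
  intro h'
  cases h'
  exact Q.side_ne h rfl

theorem exists_of_isCoatom (hQ : Q.Complete) {l : Lat Q} (h : IsCoatom l) :
    ∃ x, Q.side x = false ∧ l = el x := by
  rcases l with _ | x | _
  · obtain ⟨y, hy⟩ := hQ.exists_point
    have := h.2 (el y) (lt_of_le_of_ne (bot_le' _) (by simp))
    simp [top_def] at this
  · refine ⟨x, ?_, rfl⟩
    cases hx : Q.side x
    · rfl
    · obtain ⟨y, -, hy⟩ := exists_el_between hQ x hx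
      have := h.2 _ hy
      simp [top_def] at this
  · exact (h.1 rfl).elim

/-- A line is the join of two of its points, and the top is the join of two lines through a point;
the two neighbours given by `two_adj` are enough for both. -/
theorem isAtomistic (hQ : Q.Complete) : IsAtomistic (Lat Q) := by
  refine ⟨fun b => ⟨{a | a ≤ b ∧ IsAtom a}, ⟨fun a ha => ha.1, fun c hc => ?_⟩, fun a ha => ha.2⟩⟩
  have key : ∀ x, Q.side x = false → (el x : Lat Q) ≤ b → el x ≤ c := by
    intro x hx hb
    obtain ⟨y, z, hyz, hy, hz⟩ := hQ.two_adj x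
    have hy' := side_of_adj' hy hx
    have hz' := side_of_adj' hz hx
    have h1 : el y ≤ (el x : Lat Q) := Or.inr ⟨hy', Q.symm hy⟩
    have h2 : el z ≤ (el x : Lat Q) := Or.inr ⟨hz', Q.symm hz⟩
    refine (isLUB_points hyz hy' hy hz).2 ?_
    rintro w (rfl | rfl)
    · exact hc ⟨h1.trans hb, isAtom_el hy'⟩
    · exact hc ⟨h2.trans hb, isAtom_el hz'⟩
  rcases b with _ | x | _
  · exact bot_le' _
  · cases hx : Q.side x
    · exact key x hx le_rfl
    · exact hc ⟨le_rfl, isAtom_el hx⟩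
  · obtain ⟨x, hx⟩ := hQ.exists_point
    obtain ⟨y, z, hyz, hy, hz⟩ := hQ.two_adj x
    have hy' := side_of_adj hy hx
    have hz' := side_of_adj hz hx
    have h1 : ¬ (el y : Lat Q) ≤ el z := by
      rintro (h | ⟨h, -⟩)
      exacts [hyz h, by simp [hy'] at h]
    refine (isLUB_top h1 hz').2 ?_
    rintro w (rfl | rfl)
    exacts [key y hy' (le_top' _), key z hz' (le_top' _)]

theorem covBy_of_rank {x y : Lat Q} (h : x < y) (hr : rank y ≤ rank x + 1) : x ⋖ y :=
  ⟨h, fun z h1 h2 => by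
    have := rank_strictMono h1
    have := rank_strictMono h2
    omega⟩

theorem rank_top : rank (top : Lat Q) = 3 := rfl

theorem rank_bot : rank (bot : Lat Q) = 0 := rfl

/-- It suffices that the rank grows by at most one from `b` to `a ⊔ b`. Among incomparable flats
this fails only for a point `b` off a line `a`; there `a ⊓ b` is bottom, which `a` does not cover
because it contains a point. -/
theorem isUpperModularLattice [hQ : Fact Q.Complete] : IsUpperModularLattice (Lat Q) := by
  refine ⟨fun {a b} h => ?_⟩
  have hab : ¬ a ≤ b := fun h' => h.lt.ne (inf_eq_left.2 h')
  refine covBy_of_rank (lt_of_le_of_ne le_sup_right fun h' => hab (h' ▸ le_sup_left)) ?_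
  by_cases hba : b ≤ a
  · rw [inf_eq_right.2 hba] at h
    rw [sup_eq_left.2 hba]
    rcases b with _ | b | _
    · rcases a with _ | a | _
      · simp [rank]
      · cases ha : Q.side a
        · obtain ⟨y, -, -, hy, -⟩ := hQ.out.two_adj a
          have hy' := side_of_adj' hy ha
          refine (h.2 (c := el y) (lt_of_le_of_ne (bot_le' _) (by simp)) ?_).elim
          refine lt_of_le_of_ne (Or.inr ⟨hy', Q.symm hy⟩) fun he => ?_
          cases he
          exact Q.side_ne hy rfl
        · simp [rank, ha]
      · obtain ⟨x, hx⟩ := hQ.out.exists_point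
        exact (h.2 (c := el x) (lt_of_le_of_ne (bot_le' _) (by simp))
          (lt_of_le_of_ne (le_top' _) (by simp))).elim
    · rcases a with _ | a | _
      · simp [rank]
      · simp only [rank]; split <;> split <;> omega
      · cases hb : Q.side b
        · simp [rank, hb]
        · obtain ⟨y, -, hy⟩ := exists_el_between hQ.out b hb
          exact (h.2 hy (lt_of_le_of_ne (le_top' _) (by simp))).elim
    · exact (hab (le_top' _)).elim
  · rcases a with _ | a | _
    · exact (hab (bot_le' _)).elim
    · rcases b with _ | b | _
      · exact (hba (bot_le' _)).elim
      · cases hb : Q.side b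
        · rw [sup_eq_of_isLUB (isLUB_top hab hb), rank_top, rank_el_of_line hb]
        · rw [rank_el_of_point hb]
          cases ha : Q.side a
          · have h1 := Set.pair_comm (el b : Lat Q) (el a) ▸ isGLB_bot hba hab hb
            rw [inf_eq_of_isGLB h1] at h
            obtain ⟨y, -, -, hy, -⟩ := hQ.out.two_adj a
            have hy' := side_of_adj' hy ha
            refine (h.2 (c := el y) (lt_of_le_of_ne (bot_le' _) (by simp)) ?_).elim
            refine lt_of_le_of_ne (Or.inr ⟨hy', Q.symm hy⟩) fun he => ?_
            cases he
            exact Q.side_ne hy rfl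
          · obtain ⟨u, h1, h2⟩ := hQ.out.exists_adj a b (ha.trans hb.symm)
            rw [sup_points (fun h => hab (Or.inl h)) ha h1 h2]
            simp only [rank]; split <;> omega
      · exact (hab (le_top' _)).elim
    · exact (hba (le_top' _)).elim

theorem krullDim_eq (hQ : Q.Complete) : Order.krullDim (Lat Q) = 3 := by
  apply le_antisymm
  · refine iSup_le fun s => ?_
    have h : ∀ n (hn : n < s.length + 1), n ≤ rank (s ⟨n, hn⟩) := by
      intro n
      induction n with
      | zero => intro; omega
      | succ n ih =>
        intro hn
        have := ih (by omega)
        have := rank_strictMono (s.strictMono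
          (show (⟨n, by omega⟩ : Fin (s.length + 1)) < ⟨n + 1, hn⟩ from Nat.lt_succ_self n))
        omega
    have h3 : ∀ x : Lat Q, rank x ≤ 3 := by
      intro x
      exact (rank_strictMono.monotone (le_top' x) :)
    have := (h s.length (by omega)).trans (h3 _)
    exact_mod_cast this
  · obtain ⟨x, hx⟩ := hQ.exists_point
    obtain ⟨y, hy, hxy⟩ := exists_el_between hQ x hx
    have h1 : (bot : Lat Q) < el x := lt_of_le_of_ne (bot_le' _) (by simp)
    have h2 : (el y : Lat Q) < top := lt_of_le_of_ne (le_top' _) (by simp)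
    let s : LTSeries (Lat Q) := LTSeries.mk 3 ![bot, el x, el y, top] <| by
      rw [Fin.strictMono_iff_lt_succ]
      intro i
      fin_cases i
      exacts [h1, hxy, h2]
    exact le_iSup (fun s : LTSeries (Lat Q) => ((s.length : ℕ) : WithBot ℕ∞)) s

theorem isPlane [hQ : Fact Q.Complete] : IsPlane (Lat Q) :=
  ⟨isAtomistic hQ.out, isUpperModularLattice, krullDim_eq hQ.out⟩

theorem isProjective [hQ : Fact Q.Complete] : IsProjective (Lat Q) := by
  intro l m hl hm hlm
  obtain ⟨x, hx, rfl⟩ := exists_of_isCoatom hQ.out hl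
  obtain ⟨y, hy, rfl⟩ := exists_of_isCoatom hQ.out hm
  obtain ⟨u, h1, h2⟩ := hQ.out.exists_adj x y (hx.trans hy.symm)
  rw [inf_lines (fun h => hlm (congrArg el h)) hx h1 h2]
  exact isAtom_el (side_of_adj' (Q.symm h1) hx)

end Lat

end PartialPlane

/-! ### Invariance of the geometric properties under order isomorphism -/

section Transport

variable {α β : Type*} [Lattice α] [BoundedOrder α] [Lattice β] [BoundedOrder β]

theorem IsPlane.of_orderIso (e : α ≃o β) (h : IsPlane β) : IsPlane α := by
  have := h.atomistic
  have := h.semimodular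
  refine ⟨⟨fun b => ?_⟩, ⟨fun {a b} hab => ?_⟩, ?_⟩
  · obtain ⟨s, hs, ha⟩ := IsAtomistic.isLUB_atoms (e b)
    refine ⟨e ⁻¹' s, e.isLUB_preimage.2 hs, fun a h => (e.isAtom_iff a).1 (ha _ h)⟩
  · rw [← apply_covBy_apply_iff e, map_inf] at hab
    rw [← apply_covBy_apply_iff e, map_sup]
    exact covBy_sup_of_inf_covBy_left hab
  · rw [Order.krullDim_eq_of_orderIso e, h.length_eq_three]

theorem IsProjective.of_orderIso (e : α ≃o β) (h : IsProjective β) : IsProjective α := by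
  intro l m hl hm hlm
  rw [← e.isAtom_iff, map_inf]
  exact h _ _ ((e.isCoatom_iff l).2 hl) ((e.isCoatom_iff m).2 hm) (e.injective.ne hlm)

theorem OrderIso.liesOnLine_iff (e : α ≃o β) {x y z : α} :
    LiesOnLine (e x) (e y) (e z) ↔ LiesOnLine x y z := by
  constructor
  · rintro ⟨l, hl, h⟩
    obtain ⟨l, rfl⟩ := e.surjective l
    exact ⟨l, (e.isCoatom_iff l).1 hl, by simpa using h⟩
  · rintro ⟨l, hl, h⟩
    exact ⟨e l, (e.isCoatom_iff l).2 hl, by simpa using h⟩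

theorem IsDesarguesian.of_orderIso (e : α ≃o β) (h : IsDesarguesian β) : IsDesarguesian α := by
  intro o a b hab
  have := h (e o) (e ∘ a) (e ∘ b)
    { atom_center := (e.isAtom_iff o).2 hab.atom_center
      atom_left := fun i => (e.isAtom_iff _).2 (hab.atom_left i)
      atom_right := fun i => (e.isAtom_iff _).2 (hab.atom_right i)
      triangle_left := fun h => hab.triangle_left (e.liesOnLine_iff.1 h)
      triangle_right := fun h => hab.triangle_right (e.liesOnLine_iff.1 h)
      ne_left := fun i => e.injective.ne (hab.ne_left i)
      ne_right := fun i => e.injective.ne (hab.ne_right i)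
      ne := fun i => e.injective.ne (hab.ne i)
      collinear := fun i => e.liesOnLine_iff.2 (hab.collinear i)
      lines_ne := fun i j hij => by
        simpa only [Function.comp_apply, ← map_sup] using e.injective.ne (hab.lines_ne i j hij) }
  simpa only [Function.comp_apply, ← map_sup, ← map_inf, e.liesOnLine_iff] using this

end Transport

/-! ### Embeddings of planes and of their lattices -/

namespace PartialPlane

variable {B C D : Type*} {Q : PartialPlane B} {R : PartialPlane C} {S : PartialPlane D}

/-- The identity embedding. -/
def Emb.refl (Q : PartialPlane B) : Emb Q Q :=
  ⟨id, Function.injective_id, fun _ => rfl, fun _ _ => Iff.rfl⟩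

/-- Composition of embeddings. -/
def Emb.trans (f : Emb Q R) (g : Emb R S) : Emb Q S :=
  ⟨g.toFun ∘ f.toFun, g.injective.comp f.injective, fun x => by simp [g.side_eq, f.side_eq],
    fun x y => by simp [g.adj_iff, f.adj_iff]⟩

namespace Lat

/-- The map of flats induced by an embedding. -/
def map (f : Emb Q R) : Lat Q → Lat R
  | bot => bot
  | el x => el (f.toFun x)
  | top => top

theorem map_trans (f : Emb Q R) (g : Emb R S) (x : Lat Q) :
    map (f.trans g) x = map g (map f x) := by cases x <;> rfl

theorem map_injective (f : Emb Q R) : Function.Injective (map f) := by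
  intro x y h
  rcases x with _ | x | _ <;> rcases y with _ | y | _ <;> simp [map] at h ⊢
  exact f.injective h

theorem map_le_map_iff (f : Emb Q R) {x y : Lat Q} : map f x ≤ map f y ↔ x ≤ y := by
  rcases x with _ | x | _ <;> rcases y with _ | y | _
  case el.el => simp only [map, el_le_el, f.side_eq, f.adj_iff, f.injective.eq_iff]
  all_goals exact Iff.rfl

theorem adj_iff_le (x y : B) :
    Q.Adj x y ↔ Q.side x ≠ Q.side y ∧ ((el x : Lat Q) ≤ el y ∨ (el y : Lat Q) ≤ el x) := by
  constructor
  · intro h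
    refine ⟨Q.side_ne h, ?_⟩
    cases hx : Q.side x
    · exact Or.inr (Or.inr ⟨side_of_adj' h hx, Q.symm h⟩)
    · exact Or.inl (Or.inr ⟨hx, h⟩)
  · rintro ⟨h, (h1 | h1) | (h1 | h1)⟩
    exacts [(h (h1 ▸ rfl)).elim, h1.2, (h (h1 ▸ rfl)).elim, Q.symm h1.2]

variable [hQ : Fact Q.Complete] [hR : Fact R.Complete]

theorem map_sup_of_le (f : Emb Q R) {x y : Lat Q} (h : x ≤ y) :
    map f (x ⊔ y) = map f x ⊔ map f y := by
  rw [sup_eq_right.2 h, sup_eq_right.2 ((map_le_map_iff f).2 h)]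

theorem map_inf_of_le (f : Emb Q R) {x y : Lat Q} (h : x ≤ y) :
    map f (x ⊓ y) = map f x ⊓ map f y := by
  rw [inf_eq_left.2 h, inf_eq_left.2 ((map_le_map_iff f).2 h)]

/-- The line joining two points is sent to a common neighbour of their images, and there is only
one; so an embedding preserves joins as soon as the source is complete. -/
theorem map_sup' (f : Emb Q R) (x y : Lat Q) : map f (x ⊔ y) = map f x ⊔ map f y := by
  by_cases hxy : x ≤ y
  · exact map_sup_of_le f hxy
  by_cases hyx : y ≤ x
  · rw [sup_comm, map_sup_of_le f hyx, sup_comm]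
  rcases x with _ | x | _
  · exact (hxy (bot_le' _)).elim
  · rcases y with _ | y | _
    · exact (hyx (bot_le' _)).elim
    · have hxy' := (map_le_map_iff f).not.2 hxy
      have hyx' := (map_le_map_iff f).not.2 hyx
      cases hy : Q.side y
      · rw [sup_eq_of_isLUB (isLUB_top hxy hy)]
        exact (sup_eq_of_isLUB (isLUB_top hxy' ((f.side_eq y).trans hy))).symm
      · cases hx : Q.side x
        · rw [sup_comm, sup_eq_of_isLUB (isLUB_top hyx hx), sup_comm]
          exact (sup_eq_of_isLUB (isLUB_top hyx' ((f.side_eq x).trans hx))).symm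
        · obtain ⟨u, h1, h2⟩ := hQ.out.exists_adj x y (hx.trans hy.symm)
          have hne : x ≠ y := fun h => hxy (Or.inl h)
          rw [sup_points hne hx h1 h2]
          exact (sup_points (f.injective.ne hne) ((f.side_eq x).trans hx)
            ((f.adj_iff _ _).2 h1) ((f.adj_iff _ _).2 h2)).symm
    · exact (hxy (le_top' _)).elim
  · exact (hyx (le_top' _)).elim

theorem map_inf' (f : Emb Q R) (x y : Lat Q) : map f (x ⊓ y) = map f x ⊓ map f y := by
  by_cases hxy : x ≤ y
  · exact map_inf_of_le f hxy
  by_cases hyx : y ≤ x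
  · rw [inf_comm, map_inf_of_le f hyx, inf_comm]
  rcases x with _ | x | _
  · exact (hxy (bot_le' _)).elim
  · rcases y with _ | y | _
    · exact (hyx (bot_le' _)).elim
    · have hxy' := (map_le_map_iff f).not.2 hxy
      have hyx' := (map_le_map_iff f).not.2 hyx
      cases hx : Q.side x
      · cases hy : Q.side y
        · obtain ⟨u, h1, h2⟩ := hQ.out.exists_adj x y (hx.trans hy.symm)
          have hne : x ≠ y := fun h => hxy (Or.inl h)
          rw [inf_lines hne hx h1 h2]
          exact (inf_lines (f.injective.ne hne) ((f.side_eq x).trans hx)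
            ((f.adj_iff _ _).2 h1) ((f.adj_iff _ _).2 h2)).symm
        · rw [inf_comm, inf_eq_of_isGLB (isGLB_bot hyx hxy hy), inf_comm]
          exact (inf_eq_of_isGLB (isGLB_bot hyx' hxy' ((f.side_eq y).trans hy))).symm
      · rw [inf_eq_of_isGLB (isGLB_bot hxy hyx hx)]
        exact (inf_eq_of_isGLB (isGLB_bot hxy' hyx' ((f.side_eq x).trans hx))).symm
    · exact (hxy (le_top' _)).elim
  · exact (hyx (le_top' _)).elim

/-- The lattice homomorphism induced by an embedding. -/
def mapHom (f : Emb Q R) : BoundedLatticeHom (Lat Q) (Lat R) where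
  toFun := map f
  map_sup' := map_sup' f
  map_inf' := map_inf' f
  map_top' := rfl
  map_bot' := rfl

/-- Every element lies in a chain bottom < point < line < top. An injective homomorphism is strictly
monotone and fixes both ends, so the ranks 1 and 2 in the middle are forced. -/
theorem hom_apply_el (φ : BoundedLatticeHom (Lat Q) (Lat R)) (hφ : Function.Injective φ) (x : B) :
    ∃ y, φ (el x) = el y ∧ R.side y = Q.side x := by
  have hmono : StrictMono φ := (OrderHomClass.mono φ).strictMono_of_injective hφ
  have hb : φ bot = bot := map_bot φ
  have ht : φ top = top := map_top φ
  have main : ∀ p l : B, Q.side p = true → Q.side l = false → (el p : Lat Q) < el l →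
      rank (φ (el p)) = 1 ∧ rank (φ (el l)) = 2 := by
    intro p l _ _ hpl
    have h1 : (bot : Lat Q) < el p := lt_of_le_of_ne (bot_le' _) (by simp)
    have h2 : (el l : Lat Q) < top := lt_of_le_of_ne (le_top' _) (by simp)
    have h1 := rank_strictMono (hmono h1)
    have h2 := rank_strictMono (hmono h2)
    have h3 := rank_strictMono (hmono hpl)
    rw [hb, rank_bot] at h1
    rw [ht, rank_top] at h2
    omega
  have lift : ∀ z : Lat R, (rank z = 1 → ∃ y, z = el y ∧ R.side y = true) ∧
      (rank z = 2 → ∃ y, z = el y ∧ R.side y = false) := by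
    intro z
    rcases z with _ | z | _
    · simp [rank]
    · cases h : R.side z <;> simp [rank, h]
    · simp [rank]
  cases hx : Q.side x
  · obtain ⟨y, -, -, hy, -⟩ := hQ.out.two_adj x
    have hy' := side_of_adj' hy hx
    refine (lift _).2 (main y x hy' hx ?_).2
    refine lt_of_le_of_ne (Or.inr ⟨hy', Q.symm hy⟩) fun he => ?_
    cases he
    exact Q.side_ne hy rfl
  · obtain ⟨y, hy', hy⟩ := exists_el_between hQ.out x hx
    exact (lift _).1 (main x y hx hy' hy).1

theorem exists_emb (φ : BoundedLatticeHom (Lat Q) (Lat R)) (hφ : Function.Injective φ) :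
    ∃ f : Emb Q R, ∀ x, φ x = map f x := by
  choose f hf hs using hom_apply_el φ hφ
  have hle : ∀ x y : Lat Q, φ x ≤ φ y ↔ x ≤ y := fun x y => by
    rw [← inf_eq_left, ← inf_eq_left, ← map_inf, hφ.eq_iff]
  refine ⟨⟨f, fun x y h => ?_, hs, fun x y => ?_⟩, fun x => ?_⟩
  · have := hφ ((hf x).trans ((congrArg el h).trans (hf y).symm))
    simpa using this
  · rw [adj_iff_le, adj_iff_le, ← hf, ← hf, hle, hle, hs, hs]
  · rcases x with _ | x | _
    exacts [map_bot φ, hf x, map_top φ]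

/-- The order isomorphism induced by a pair of mutually inverse embeddings. -/
def mapIso (f : Emb Q R) (g : Emb R Q) (hfg : ∀ x, g.toFun (f.toFun x) = x)
    (hgf : ∀ x, f.toFun (g.toFun x) = x) : Lat Q ≃o Lat R where
  toFun := map f
  invFun := map g
  left_inv x := by cases x <;> simp [map, hfg]
  right_inv x := by cases x <;> simp [map, hgf]
  map_rel_iff' := map_le_map_iff f

end Lat

end PartialPlane

/-! ### The free completion of a partial plane -/

namespace PartialPlane

/-- Formal elements of the free completion of a partial plane on `B`: `join s t` is the line
joining two points, or the meet of two lines. -/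
inductive Term (B : Type*)
  | base (b : B) : Term B
  | join (s t : Term B) : Term B

namespace Term

variable {B C : Type*}

/-- A code for a formal element. -/
def code [Encodable B] : Term B → ℕ
  | base b => 2 * Encodable.encode b
  | join s t => 2 * Nat.pair s.code t.code + 1

/-- Even codes belong to base elements and odd codes to joins. -/
theorem code_injective [Encodable B] : Function.Injective (code : Term B → ℕ) := by
  intro s
  induction s with
  | base b =>
    intro t h
    cases t with
    | base c =>
      simp only [code] at h
      rw [Encodable.encode_injective (show Encodable.encode b = Encodable.encode c by omega)]
    | join t₁ t₂ => simp only [code] at h; omega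
  | join s₁ s₂ ih₁ ih₂ =>
    intro t h
    cases t with
    | base c => simp only [code] at h; omega
    | join t₁ t₂ =>
      simp only [code] at h
      have h' := Nat.pair_eq_pair.1
        (show Nat.pair s₁.code s₂.code = Nat.pair t₁.code t₂.code by omega)
      rw [ih₁ h'.1, ih₂ h'.2]

instance [Encodable B] : Countable (Term B) := code_injective.countable

/-- The number of joins in a formal element. -/
def size : Term B → ℕ
  | base _ => 0
  | join s t => s.size + t.size + 1

/-- `x` is one of the two elements which `y` joins. -/
def Child (x : Term B) : Term B → Prop
  | base _ => False
  | join s t => x = s ∨ x = t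

theorem Child.size_lt {x y : Term B} (h : Child x y) : x.size < y.size := by
  cases y with
  | base b => exact h.elim
  | join s t => rcases h with rfl | rfl <;> simp only [size] <;> omega

variable [Encodable B] [Encodable C]

/-- The formal join, with its arguments in increasing order. -/
def symJoin (s t : Term B) : Term B := if s.code < t.code then join s t else join t s

theorem symJoin_eq_or (s t : Term B) : symJoin s t = join s t ∨ symJoin s t = join t s := by
  unfold symJoin
  split <;> simp

theorem child_symJoin {x s t : Term B} : Child x (symJoin s t) ↔ x = s ∨ x = t := by
  rcases symJoin_eq_or s t with h | h <;> rw [h]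
  · rfl
  · exact or_comm

theorem symJoin_inj {s t s' t' : Term B} (h : symJoin s t = symJoin s' t') :
    (s = s' ∧ t = t') ∨ (s = t' ∧ t = s') := by
  rcases symJoin_eq_or s t with h₁ | h₁ <;> rcases symJoin_eq_or s' t' with h₂ | h₂ <;>
    rw [h₁, h₂] at h <;> injection h with h₃ h₄ <;> simp [h₃, h₄]

/-- The map of formal elements induced by a map of base elements. -/
def map (g : B → C) : Term B → Term C
  | base b => base (g b)
  | join s t => symJoin (map g s) (map g t)

end Term

open Term

section Valid

variable {B : Type*} (P : PartialPlane B)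

/-- The side of a formal element. -/
def termSide : Term B → Bool
  | base b => P.side b
  | join s _ => !(termSide s)

/-- Incidence of base elements. -/
def BaseAdj : Term B → Term B → Prop
  | base b, base c => P.Adj b c
  | _, _ => False

/-- Incidence of formal elements. -/
def TermAdj (x y : Term B) : Prop := Child x y ∨ Child y x ∨ P.BaseAdj x y

/-- The elements `s` and `t` have a common neighbour other than their formal join. -/
def Joined (s t : Term B) : Prop :=
  ∃ u, P.TermAdj u s ∧ P.TermAdj u t ∧ ¬ (Child s u ∧ Child t u)

variable [Encodable B]

/-- The formal elements which belong to the free completion. -/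
def Valid : Term B → Prop
  | base _ => True
  | join s t => s.code < t.code ∧ Valid s ∧ Valid t ∧ P.termSide s = P.termSide t ∧ ¬ P.Joined s t

end Valid

section Free

variable {B : Type*} {P : PartialPlane B}

theorem BaseAdj.exists {x y : Term B} (h : P.BaseAdj x y) :
    ∃ b c, x = base b ∧ y = base c ∧ P.Adj b c := by
  cases x <;> cases y
  case base.base b c => exact ⟨b, c, rfl, rfl, h⟩
  all_goals exact h.elim

theorem BaseAdj.symm {x y : Term B} (h : P.BaseAdj x y) : P.BaseAdj y x := by
  obtain ⟨b, c, rfl, rfl, h⟩ := h.exists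
  exact P.symm h

theorem TermAdj.symm {x y : Term B} (h : P.TermAdj x y) : P.TermAdj y x := by
  rcases h with h | h | h
  exacts [Or.inr (Or.inl h), Or.inl h, Or.inr (Or.inr h.symm)]

theorem Joined.symm {s t : Term B} (h : P.Joined s t) : P.Joined t s := by
  obtain ⟨u, h1, h2, h3⟩ := h
  exact ⟨u, h2, h1, fun h => h3 h.symm⟩

/-- A neighbour which is not larger is a child, or else both elements are base elements. -/
theorem TermAdj.of_size_le {x y : Term B} (h : P.TermAdj x y) (hs : x.size ≤ y.size) :
    Child x y ∨ P.BaseAdj x y := by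
  rcases h with h | h | h
  · exact Or.inl h
  · exact absurd h.size_lt (by omega)
  · exact Or.inr h

theorem exists_base_of_size {x : Term B} (h : x.size = 0) : ∃ b, x = base b := by
  cases x with
  | base b => exact ⟨b, rfl⟩
  | join s t => simp [size] at h

theorem termAdj_base {b c : B} : P.TermAdj (base b) (base c) ↔ P.Adj b c := by
  simp [TermAdj, Child, BaseAdj]

variable [Encodable B]

theorem Valid.child {x y : Term B} (hy : P.Valid y) (h : Child x y) : P.Valid x := by
  cases y with
  | base b => exact h.elim
  | join s t => rcases h with rfl | rfl; exacts [hy.2.1, hy.2.2.1]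

theorem Valid.side_child {x y : Term B} (hy : P.Valid y) (h : Child x y) :
    P.termSide x ≠ P.termSide y := by
  cases y with
  | base b => exact h.elim
  | join s t =>
    rcases h with rfl | rfl
    · simp [termSide]
    · simp [termSide, hy.2.2.2.1]

theorem TermAdj.side_ne {x y : Term B} (h : P.TermAdj x y) (hx : P.Valid x) (hy : P.Valid y) :
    P.termSide x ≠ P.termSide y := by
  rcases h with h | h | h
  · exact hy.side_child h
  · exact (hx.side_child h).symm
  · obtain ⟨b, c, rfl, rfl, h⟩ := h.exists
    exact P.side_ne h

theorem Valid.mk {s t : Term B} (hs : P.Valid s) (ht : P.Valid t) (hne : s ≠ t)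
    (hside : P.termSide s = P.termSide t) (hj : ¬ P.Joined s t) : P.Valid (Term.symJoin s t) := by
  unfold Term.symJoin
  split_ifs with h
  · exact ⟨h, hs, ht, hside, hj⟩
  · exact ⟨lt_of_le_of_ne (not_lt.1 h) fun h' => hne (code_injective h'.symm), ht, hs,
      hside.symm, fun h => hj h.symm⟩

/-- The increasing order of codes in a valid join leaves only one way to join two given terms. -/
theorem Valid.eq_of_children {s t v : Term B} (hu : P.Valid (join s t)) (hv : P.Valid v)
    (hs : Child s v) (ht : Child t v) : v = join s t := by
  cases v with
  | base b => exact hs.elim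
  | join a b =>
    have h1 := hu.1
    have h2 := hv.1
    rcases hs with rfl | rfl <;> rcases ht with rfl | rfl
    · omega
    · rfl
    · omega
    · omega

/-- Here `u` is a largest corner of the quadrilateral `u x v y`. If `u` is a join, then `x` and `y`
are among its children; when they are distinct, a second common neighbour `v` contradicts the clause
`¬ Joined` unless it has the same two children, and then it equals `u`. If `u` is a base element, so
are all four. -/
theorem eq_or_eq_of_size_le {x y u v : Term B} (hu : P.Valid u) (hv : P.Valid v)
    (hux : P.TermAdj u x) (huy : P.TermAdj u y) (hvx : P.TermAdj v x) (hvy : P.TermAdj v y)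
    (hxu : x.size ≤ u.size) (hyu : y.size ≤ u.size) (hvu : v.size ≤ u.size) :
    x = y ∨ u = v := by
  have h1 := hux.symm.of_size_le hxu
  have h2 := huy.symm.of_size_le hyu
  cases u with
  | base b =>
    obtain ⟨x, rfl⟩ := exists_base_of_size (Nat.le_zero.1 hxu)
    obtain ⟨y, rfl⟩ := exists_base_of_size (Nat.le_zero.1 hyu)
    obtain ⟨v, rfl⟩ := exists_base_of_size (Nat.le_zero.1 hvu)
    rw [termAdj_base] at *
    rcases P.unique hux huy hvx hvy with rfl | rfl <;> simp
  | join s t =>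
    have no : ∀ z, ¬ P.BaseAdj z (join s t) := fun z h => by
      obtain ⟨b, c, -, h, -⟩ := h.exists
      cases h
    replace h1 := h1.resolve_right (no _)
    replace h2 := h2.resolve_right (no _)
    by_contra! hne
    have key : Child s v ∧ Child t v := by
      by_contra hc
      refine hu.2.2.2.2 ⟨v, ?_, ?_, hc⟩
      all_goals rcases h1 with rfl | rfl <;> rcases h2 with rfl | rfl <;> simp_all
    exact hne.2 (hu.eq_of_children hv key.1 key.2).symm

theorem TermAdj.unique {x y u v : Term B} (hx : P.Valid x) (hy : P.Valid y) (hu : P.Valid u)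
    (hv : P.Valid v) (hux : P.TermAdj u x) (huy : P.TermAdj u y) (hvx : P.TermAdj v x)
    (hvy : P.TermAdj v y) : x = y ∨ u = v := by
  -- Some corner of the quadrilateral has maximal size, and the statement is symmetric in the four
  -- corners.
  have h : (x.size ≤ u.size ∧ y.size ≤ u.size ∧ v.size ≤ u.size) ∨
      (x.size ≤ v.size ∧ y.size ≤ v.size ∧ u.size ≤ v.size) ∨
      (u.size ≤ x.size ∧ v.size ≤ x.size ∧ y.size ≤ x.size) ∨
      (u.size ≤ y.size ∧ v.size ≤ y.size ∧ x.size ≤ y.size) := by omega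
  rcases h with ⟨h1, h2, h3⟩ | ⟨h1, h2, h3⟩ | ⟨h1, h2, h3⟩ | ⟨h1, h2, h3⟩
  · exact eq_or_eq_of_size_le hu hv hux huy hvx hvy h1 h2 h3
  · exact (eq_or_eq_of_size_le hv hu hvx hvy hux huy h1 h2 h3).imp_right Eq.symm
  · exact (eq_or_eq_of_size_le hx hy hux.symm hvx.symm huy.symm hvy.symm h1 h2 h3).symm
  · exact (eq_or_eq_of_size_le hy hx huy.symm hvy.symm hux.symm hvx.symm h1 h2 h3).symm.imp_left
      Eq.symm

/-- `Joined` quantifies over all terms, valid or not, which lets `Valid` be a structural recursion.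
Nothing is lost: a common neighbour that does not have both terms as children is a child of one of
them or a base element, hence valid. -/
theorem Valid.of_common {u s t : Term B} (hs : P.Valid s) (ht : P.Valid t) (h1 : P.TermAdj u s)
    (h2 : P.TermAdj u t) (h3 : ¬ (Child s u ∧ Child t u)) : P.Valid u := by
  rcases h1 with h1 | h1 | h1
  · exact hs.child h1
  · rcases h2 with h2 | h2 | h2
    · exact ht.child h2
    · exact (h3 ⟨h1, h2⟩).elim
    · obtain ⟨b, c, rfl, rfl, -⟩ := h2.exists
      trivial
  · obtain ⟨b, c, rfl, rfl, -⟩ := h1.exists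
    trivial

theorem Valid.exists_adj {s t : Term B} (hs : P.Valid s) (ht : P.Valid t) (hne : s ≠ t)
    (hside : P.termSide s = P.termSide t) : ∃ u, P.Valid u ∧ P.TermAdj u s ∧ P.TermAdj u t := by
  by_cases hj : P.Joined s t
  · obtain ⟨u, h1, h2, h3⟩ := hj
    exact ⟨u, hs.of_common ht h1 h2 h3, h1, h2⟩
  · exact ⟨Term.symJoin s t, hs.mk ht hne hside hj, Or.inr (Or.inl (child_symJoin.2 (Or.inl rfl))),
      Or.inr (Or.inl (child_symJoin.2 (Or.inr rfl)))⟩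

variable (P) in
/-- The free completion of a partial plane. -/
def free : PartialPlane {t : Term B // P.Valid t} where
  side t := P.termSide t
  Adj s t := P.TermAdj s t
  symm h := h.symm
  side_ne {x y} h := h.side_ne x.2 y.2
  unique {x y u v} h1 h2 h3 h4 := by
    simpa only [Subtype.ext_iff] using TermAdj.unique x.2 y.2 u.2 v.2 h1 h2 h3 h4

variable (P) in
/-- The base elements of the free completion. -/
def ofBase (b : B) : {t : Term B // P.Valid t} := ⟨base b, trivial⟩

theorem ofBase_injective : Function.Injective P.ofBase := fun _ _ h =>
  Term.base.inj (congrArg Subtype.val h)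

theorem free_adj_ofBase {b c : B} : P.free.Adj (P.ofBase b) (P.ofBase c) ↔ P.Adj b c :=
  termAdj_base

theorem free_complete (hP : ∀ b, ∃ c d, c ≠ d ∧ P.Adj b c ∧ P.Adj b d)
    (hpt : ∃ b, P.side b = true) : P.free.Complete := by
  have two : ∀ x, ∃ y z, y ≠ z ∧ P.free.Adj x y ∧ P.free.Adj x z := by
    rintro ⟨x, hx⟩
    cases x with
    | base b =>
      obtain ⟨c, d, hne, hc, hd⟩ := hP b
      exact ⟨P.ofBase c, P.ofBase d, ofBase_injective.ne hne, termAdj_base.2 hc,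
        termAdj_base.2 hd⟩
    | join s t =>
      refine ⟨⟨s, hx.2.1⟩, ⟨t, hx.2.2.1⟩, fun h => ?_, Or.inr (Or.inl (Or.inl rfl)),
        Or.inr (Or.inl (Or.inr rfl))⟩
      have h' : s = t := congrArg Subtype.val h
      exact absurd hx.1 (by simp [h'])
  refine ⟨fun x y h => ?_, two, ?_⟩
  · by_cases hxy : x = y
    · subst hxy
      obtain ⟨y, -, -, hy, -⟩ := two x
      exact ⟨y, P.free.symm hy, P.free.symm hy⟩
    · obtain ⟨u, hu, h1, h2⟩ := x.2.exists_adj y.2 (fun h => hxy (Subtype.ext h)) h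
      exact ⟨⟨u, hu⟩, h1, h2⟩
  · obtain ⟨b, hb⟩ := hpt
    exact ⟨P.ofBase b, hb⟩

/-- Finite configurations in which every element has at least three neighbours consist of base
elements. -/
theorem exists_base_of_confined {K : Set {t : Term B // P.Valid t}} (hfin : K.Finite)
    (h3 : ∀ x ∈ K, ∃ y₁ ∈ K, ∃ y₂ ∈ K, ∃ y₃ ∈ K, y₁ ≠ y₂ ∧ y₁ ≠ y₃ ∧ y₂ ≠ y₃ ∧
      P.free.Adj x y₁ ∧ P.free.Adj x y₂ ∧ P.free.Adj x y₃)
    {x : {t : Term B // P.Valid t}} (hx : x ∈ K) : ∃ b, x = P.ofBase b := by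
  -- If a term of maximal size in `K` were a join, its neighbours in `K` would not be larger, hence
  -- would be among its two children.
  obtain ⟨m, hm, hmax⟩ := Set.exists_max_image K (fun t => t.1.size) hfin ⟨x, hx⟩
  have h0 : m.1.size = 0 := by
    obtain ⟨y₁, k₁, y₂, k₂, y₃, k₃, n₁, n₂, n₃, a₁, a₂, a₃⟩ := h3 m hm
    obtain ⟨m, hmv⟩ := m
    cases m with
    | base b => rfl
    | join s t =>
      have no : ∀ y ∈ K, P.free.Adj ⟨join s t, hmv⟩ y → y.1 = s ∨ y.1 = t := by
        intro y hy h
        rcases (TermAdj.symm h).of_size_le (hmax y hy) with h | h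
        · exact h
        · obtain ⟨b, c, -, h, -⟩ := h.exists
          cases h
      simp only [ne_eq, Subtype.ext_iff] at n₁ n₂ n₃
      have := no _ k₁ a₁
      have := no _ k₂ a₂
      have := no _ k₃ a₃
      grind
  have hx0 : x.1.size = 0 := Nat.le_zero.1 (h0 ▸ hmax x hx)
  obtain ⟨b, hb⟩ := exists_base_of_size hx0
  exact ⟨b, Subtype.ext hb⟩

end Free

/-! ### Functoriality of the free completion -/

section Map

variable {B C : Type*} [Encodable C] {P : PartialPlane B} {R : PartialPlane C}

/-- An embedding of partial planes is closed if its range contains all common neighbours of two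
elements of the range. -/
def Emb.IsClosed (g : Emb P R) : Prop :=
  ∀ x y u, x ≠ y → R.Adj u (g.toFun x) → R.Adj u (g.toFun y) → ∃ v, u = g.toFun v

theorem baseAdj_map_iff (g : Emb P R) {s t : Term B} :
    R.BaseAdj (map g.toFun s) (map g.toFun t) ↔ P.BaseAdj s t := by
  constructor
  · intro h
    cases s with
    | base b =>
      cases t with
      | base c => exact (g.adj_iff b c).1 h
      | join t₁ t₂ =>
        obtain ⟨_, c, -, h, -⟩ := h.exists
        rcases symJoin_eq_or (map g.toFun t₁) (map g.toFun t₂) with h' | h' <;> simp [map, h'] at h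
    | join t₁ t₂ =>
      obtain ⟨c, _, h, -, -⟩ := h.exists
      rcases symJoin_eq_or (map g.toFun t₁) (map g.toFun t₂) with h' | h' <;> simp [map, h'] at h
  · intro h
    obtain ⟨b, c, rfl, rfl, h⟩ := h.exists
    exact (g.adj_iff b c).2 h

theorem exists_of_child_map {g : B → C} {t : Term B} {u : Term C} (h : Child u (map g t)) :
    ∃ v, u = map g v ∧ Child v t := by
  cases t with
  | base b => exact h.elim
  | join s t =>
    rcases child_symJoin.1 h with h | h
    exacts [⟨s, h, Or.inl rfl⟩, ⟨t, h, Or.inr rfl⟩]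

theorem exists_of_baseAdj_map {g : B → C} {t : Term B} {u : Term C}
    (h : R.BaseAdj u (map g t)) : ∃ c b, u = base c ∧ t = base b ∧ R.Adj c (g b) := by
  cases t with
  | base b =>
    obtain ⟨c, b', rfl, hb, h⟩ := h.exists
    cases hb
    exact ⟨c, b, rfl, rfl, h⟩
  | join t₁ t₂ =>
    obtain ⟨_, c, -, h, -⟩ := h.exists
    rcases symJoin_eq_or (map g t₁) (map g t₂) with h' | h' <;> simp [map, h'] at h

variable [Encodable B]

/-- Validity matters: `join s t` and `join t s` have the same image, but at most one of them is
valid. -/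
theorem Valid.map_inj {g : B → C} (hg : Function.Injective g) {s : Term B} (hs : P.Valid s)
    {t : Term B} (ht : P.Valid t) (h : map g s = map g t) : s = t := by
  induction s generalizing t with
  | base b =>
    cases t with
    | base c =>
      simp only [map, Term.base.injEq] at h
      rw [hg h]
    | join t₁ t₂ => rcases symJoin_eq_or (map g t₁) (map g t₂) with h' | h' <;> simp [map, h'] at h
  | join s₁ s₂ ih₁ ih₂ =>
    cases t with
    | base c => rcases symJoin_eq_or (map g s₁) (map g s₂) with h' | h' <;> simp [map, h'] at h
    | join t₁ t₂ =>
      rcases symJoin_inj h with ⟨h₁, h₂⟩ | ⟨h₁, h₂⟩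
      · rw [ih₁ hs.2.1 ht.2.1 h₁, ih₂ hs.2.2.1 ht.2.2.1 h₂]
      · have := ih₁ hs.2.1 ht.2.2.1 h₁
        have := ih₂ hs.2.2.1 ht.2.1 h₂
        subst_vars
        exact absurd hs.1 (lt_asymm ht.1)

theorem child_map_iff {g : B → C} (hg : Function.Injective g) {s t : Term B} (hs : P.Valid s)
    (ht : P.Valid t) : Child (map g s) (map g t) ↔ Child s t := by
  cases t with
  | base c => rfl
  | join t₁ t₂ =>
    exact child_symJoin.trans
      (or_congr ⟨hs.map_inj hg ht.2.1, congrArg _⟩ ⟨hs.map_inj hg ht.2.2.1, congrArg _⟩)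

theorem termAdj_map_iff (g : Emb P R) {s t : Term B} (hs : P.Valid s) (ht : P.Valid t) :
    R.TermAdj (map g.toFun s) (map g.toFun t) ↔ P.TermAdj s t := by
  simp only [TermAdj, child_map_iff g.injective hs ht, child_map_iff g.injective ht hs,
    baseAdj_map_iff]

theorem termSide_map (g : Emb P R) {s : Term B} (hs : P.Valid s) :
    R.termSide (map g.toFun s) = P.termSide s := by
  induction s with
  | base b => exact g.side_eq b
  | join s t ihs iht =>
    rcases symJoin_eq_or (map g.toFun s) (map g.toFun t) with h' | h' <;> simp only [map, h', termSide]
    · rw [ihs hs.2.1]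
    · rw [iht hs.2.2.1, hs.2.2.2.1]

/-- A common neighbour of the images is either a child of one of them, hence itself an image, or a
base element incident with two base elements of the range. Closedness of `g` is used in the second
case. -/
theorem joined_of_map (g : Emb P R) (hg : g.IsClosed) {s t : Term B} (hs : P.Valid s)
    (ht : P.Valid t) (hne : s ≠ t) (h : R.Joined (map g.toFun s) (map g.toFun t)) :
    P.Joined s t := by
  obtain ⟨u, h1, h2, h3⟩ := h
  have key : ∃ v, u = map g.toFun v ∧ P.Valid v := by
    rcases h1 with h1 | h1 | h1
    · obtain ⟨v, hv, hc⟩ := exists_of_child_map h1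
      exact ⟨v, hv, hs.child hc⟩
    · rcases h2 with h2 | h2 | h2
      · obtain ⟨v, hv, hc⟩ := exists_of_child_map h2
        exact ⟨v, hv, ht.child hc⟩
      · exact (h3 ⟨h1, h2⟩).elim
      · obtain ⟨c, b, rfl, rfl, h⟩ := exists_of_baseAdj_map h2
        exact h1.elim
    · obtain ⟨c, b, rfl, rfl, h⟩ := exists_of_baseAdj_map h1
      rcases h2 with h2 | h2 | h2
      · obtain ⟨v, hv, hc⟩ := exists_of_child_map h2
        exact ⟨v, hv, ht.child hc⟩
      · exact h2.elim
      · obtain ⟨c', b', hc', rfl, h'⟩ := exists_of_baseAdj_map h2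
        cases hc'
        obtain ⟨v, rfl⟩ := hg b b' c (fun h => hne (congrArg _ h)) h h'
        exact ⟨base v, rfl, trivial⟩
  obtain ⟨v, rfl, hv⟩ := key
  exact ⟨v, (termAdj_map_iff g hv hs).1 h1, (termAdj_map_iff g hv ht).1 h2, fun h =>
    h3 ⟨(child_map_iff g.injective hs hv).2 h.1, (child_map_iff g.injective ht hv).2 h.2⟩⟩

theorem Valid.map (g : Emb P R) (hg : g.IsClosed) {s : Term B} (hs : P.Valid s) :
    R.Valid (map g.toFun s) := by
  induction s with
  | base b => trivial
  | join s t ihs iht =>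
    have hne : s ≠ t := fun h => absurd hs.1 (by simp [h])
    exact (ihs hs.2.1).mk (iht hs.2.2.1) (fun h => hne (hs.2.1.map_inj g.injective hs.2.2.1 h))
      (by rw [termSide_map g hs.2.1, termSide_map g hs.2.2.1, hs.2.2.2.1])
      fun h => hs.2.2.2.2 (joined_of_map g hg hs.2.1 hs.2.2.1 hne h)

/-- The embedding of free completions induced by a closed embedding. -/
def freeMap (g : Emb P R) (hg : g.IsClosed) : Emb P.free R.free where
  toFun t := ⟨map g.toFun t.1, t.2.map g hg⟩
  injective s t h := Subtype.ext (s.2.map_inj g.injective t.2 (congrArg Subtype.val h))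
  side_eq t := termSide_map g t.2
  adj_iff s t := termAdj_map_iff g s.2 t.2

/-- Embeddings of free completions are determined by their values at the base elements. -/
theorem Emb.ext_base {f g : Emb P.free R.free}
    (h : ∀ b, f.toFun (P.ofBase b) = g.toFun (P.ofBase b)) : f = g := by
  have key : ∀ (s : Term B) (hs : P.Valid s), f.toFun ⟨s, hs⟩ = g.toFun ⟨s, hs⟩ := by
    intro s
    induction s with
    | base b => exact fun _ => h b
    | join s t ihs iht =>
      intro hst
      have hne : s ≠ t := fun h => absurd hst.1 (by simp [h])
      have h1 : P.free.Adj ⟨_, hst⟩ ⟨s, hst.2.1⟩ := Or.inr (Or.inl (Or.inl rfl))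
      have h2 : P.free.Adj ⟨_, hst⟩ ⟨t, hst.2.2.1⟩ := Or.inr (Or.inl (Or.inr rfl))
      have f1 := (f.adj_iff _ _).2 h1
      have f2 := (f.adj_iff _ _).2 h2
      have g1 := (g.adj_iff _ _).2 h1
      have g2 := (g.adj_iff _ _).2 h2
      rw [← ihs] at g1
      rw [← iht] at g2
      -- By induction `f` and `g` agree on both children, and both send the join to a common
      -- neighbour of the same two distinct elements.
      refine (R.free.unique f1 f2 g1 g2).resolve_left fun h => hne ?_
      simpa using f.injective h
  exact Emb.ext fun x => key x.1 x.2

end Map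

end PartialPlane

/-! ### The partial plane of a graph -/

namespace PartialPlane

/-- Each vertex of a graph on `ℕ` gives rise to two indices. -/
abbrev Index : Type := ℕ × Bool

/-- The elements of the partial plane attached to a graph: the points `center`, `color k` and
`cell i j`, and the lines `row i`, `col j`, `diag {i, j}` and `axis`. -/
inductive Elt : Type
  | center : Elt
  | color (k : Fin 3) : Elt
  | cell (i j : Index) (h : i ≠ j) : Elt
  | row (i : Index) : Elt
  | col (j : Index) : Elt
  | diag (e : Sym2 Index) (h : ¬ e.IsDiag) : Elt
  | axis : Elt

namespace Elt

/-- An injection of the elements into a countable type. -/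
def tuple : Elt → ℕ × Fin 3 × Index × Index × Sym2 Index
  -- Missing entries are filled with vertex 0, so that they never violate a bound `< n` with `n > 0`
  -- in `boundedTuples`.
  | center => (0, 0, (0, true), (0, true), s((0, true), (0, true)))
  | color k => (1, k, (0, true), (0, true), s((0, true), (0, true)))
  | cell i j _ => (2, 0, i, j, s((0, true), (0, true)))
  | row i => (3, 0, i, (0, true), s((0, true), (0, true)))
  | col j => (4, 0, (0, true), j, s((0, true), (0, true)))
  | diag e _ => (5, 0, (0, true), (0, true), e)
  | axis => (6, 0, (0, true), (0, true), s((0, true), (0, true)))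

theorem tuple_injective : Function.Injective tuple := by
  intro x y h
  cases x <;> cases y <;> simp_all [tuple]

instance : Countable Elt := tuple_injective.countable

noncomputable instance : Encodable Elt := Encodable.ofCountable Elt

/-- Points and lines. -/
def isPoint : Elt → Bool
  | center => true
  | color _ => true
  | cell _ _ _ => true
  | _ => false

/-- The effect of a map of vertices on the indices. -/
def mapIndex (ρ : ℕ → ℕ) (i : Index) : Index := (ρ i.1, i.2)

theorem mapIndex_injective {ρ : ℕ → ℕ} (hρ : Function.Injective ρ) :
    Function.Injective (mapIndex ρ) := fun i j h => by
  simp only [mapIndex, Prod.mk.injEq] at h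
  exact Prod.ext (hρ h.1) h.2

theorem not_isDiag_map {σ : Index → Index} (hσ : Function.Injective σ) {e : Sym2 Index}
    (h : ¬ e.IsDiag) : ¬ (e.map σ).IsDiag := by
  induction e with
  | _ i j =>
    simp only [Sym2.map_mk, Sym2.mk_isDiag_iff] at h ⊢
    exact hσ.ne h

/-- The effect of an injective map of indices on the elements. -/
def map (σ : Index → Index) (hσ : Function.Injective σ) : Elt → Elt
  | center => center
  | color k => color k
  | cell i j h => cell (σ i) (σ j) (hσ.ne h)
  | row i => row (σ i)
  | col j => col (σ j)
  | diag e h => diag (e.map σ) (not_isDiag_map hσ h)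
  | axis => axis

end Elt

open Elt

section GraphPlane

variable (Γ : SimpleGraph ℕ)

open scoped Classical in
/-- The color of a pair of indices, which depends on the graph for indices of the first kind. -/
noncomputable def pairColor : Index → Index → Fin 3
  | (u, false), (v, false) => if Γ.Adj u v then 0 else 1
  | (_, true), (_, true) => 2
  -- In colour 0 the two kinds of indices are perfectly matched. This ties the two indices of a
  -- vertex together, and makes colours 0 and 1 behave differently.
  | (u, false), (v, true) => if u = v then 0 else 1
  | (u, true), (v, false) => if u = v then 0 else 1

theorem pairColor_eq_two_iff {Γ : SimpleGraph ℕ} {i j : Index} :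
    pairColor Γ i j = 2 ↔ i.2 = true ∧ j.2 = true := by
  rcases i with ⟨u, _ | _⟩ <;> rcases j with ⟨v, _ | _⟩ <;> simp only [pairColor] <;>
    (try split_ifs) <;> simp

theorem pairColor_eq_zero_iff {Γ : SimpleGraph ℕ} {u v : ℕ} :
    pairColor Γ (u, false) (v, false) = 0 ↔ Γ.Adj u v := by
  simp only [pairColor]
  split_ifs with h <;> simp [h]

/-- Every pair chosen contains an index of the second kind, so its colour is the same for all
graphs. Lying on two diagonals will tell colour points apart from cells. -/
theorem exists_pairs_of_color (k : Fin 3) : ∃ i j, i ≠ j ∧ pairColor Γ i j = k ∧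
    ∃ i' j', i' ≠ j' ∧ pairColor Γ i' j' = k ∧ s(i, j) ≠ s(i', j') := by
  fin_cases k
  · exact ⟨(0, false), (0, true), by simp, rfl, (1, false), (1, true), by simp, rfl, by simp⟩
  · exact ⟨(0, false), (1, true), by simp, rfl, (1, false), (0, true), by simp, rfl, by simp⟩
  · exact ⟨(0, true), (1, true), by simp, rfl, (0, true), (2, true), by simp, rfl, by simp⟩

theorem pairColor_comm (i j : Index) : pairColor Γ i j = pairColor Γ j i := by
  rcases i with ⟨u, _ | _⟩ <;> rcases j with ⟨v, _ | _⟩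
  · by_cases h : Γ.Adj u v <;> simp [pairColor, h, Γ.adj_comm v u]
  all_goals simp [pairColor, eq_comm]

/-- The color of an unordered pair of indices. -/
noncomputable def edgeColor : Sym2 Index → Fin 3 := Sym2.lift ⟨pairColor Γ, pairColor_comm Γ⟩

@[simp] theorem edgeColor_mk (i j : Index) : edgeColor Γ s(i, j) = pairColor Γ i j := rfl

/-- Incidence of a point with a line. -/
def Inc : Elt → Elt → Prop
  | center, row _ => True
  | center, axis => True
  | color k, diag e _ => edgeColor Γ e = k
  | color k, axis => k ≠ 2
  | cell i _ _, row i' => i = i'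
  | cell _ j _, col j' => j = j'
  | cell i j _, diag e _ => e = s(i, j)
  | _, _ => False

variable {Γ}

theorem Inc.sides {x y : Elt} (h : Inc Γ x y) : isPoint x = true ∧ isPoint y = false := by
  cases x <;> cases y <;> simp_all [Inc, isPoint]

/-- Two cells share at most one line because the cells of a diagonal are transposes of each other,
with distinct indices. A diagonal has a single colour, so two colours can only share `axis`;
`center` and a colour also share only `axis`. -/
theorem Inc.unique {x y l m : Elt} (h₁ : Inc Γ x l) (h₂ : Inc Γ y l) (h₃ : Inc Γ x m)
    (h₄ : Inc Γ y m) : x = y ∨ l = m := by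
  cases x <;> cases y <;> cases l <;> cases m <;> simp_all [Inc]
  all_goals grind [Sym2.eq_iff]

variable (Γ) in
/-- The partial plane attached to a graph. -/
def graphPlane : PartialPlane Elt where
  side := isPoint
  Adj x y := Inc Γ x y ∨ Inc Γ y x
  symm h := h.symm
  side_ne h := by
    rcases h with h | h <;> simp [h.sides]
  unique {x y u v} h₁ h₂ h₃ h₄ := by
    have : ∀ {x y}, isPoint x = true → Inc Γ x y ∨ Inc Γ y x → Inc Γ x y := by
      intro x y hx h
      exact h.resolve_right fun h => by simp [h.sides.2] at hx
    cases hu : isPoint u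
    · have aux : ∀ {x}, Inc Γ u x ∨ Inc Γ x u → Inc Γ x u := fun h =>
        h.resolve_left fun h => by simp [h.sides.1] at hu
      have hx := (aux h₁).sides.1
      have hy := (aux h₂).sides.1
      exact Inc.unique (aux h₁) (aux h₂) (this hx h₃.symm) (this hy h₄.symm)
    · have hx := (this hu h₁).sides.2
      have aux : ∀ {x v}, isPoint x = false → Inc Γ v x ∨ Inc Γ x v → Inc Γ v x := fun hx h =>
        h.resolve_right fun h => by simp [h.sides.1] at hx
      have hy := (this hu h₂).sides.2
      exact (Inc.unique (this hu h₁) (aux hx h₃) (this hu h₂) (aux hy h₄)).symm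

theorem graphPlane_adj {x y : Elt} : (graphPlane Γ).Adj x y ↔ Inc Γ x y ∨ Inc Γ y x := Iff.rfl

theorem graphPlane_side (x : Elt) : (graphPlane Γ).side x = isPoint x := rfl

variable {Γ₁ Γ₂ Γ₃ : SimpleGraph ℕ}

theorem pairColor_map (ρ : Γ₁ ↪g Γ₂) (i j : Index) :
    pairColor Γ₂ (mapIndex ρ i) (mapIndex ρ j) = pairColor Γ₁ i j := by
  rcases i with ⟨u, _ | _⟩ <;> rcases j with ⟨v, _ | _⟩
  · by_cases h : Γ₁.Adj u v <;> simp [pairColor, mapIndex, h]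
  all_goals simp [pairColor, mapIndex]

theorem inc_map_iff (ρ : Γ₁ ↪g Γ₂) (x y : Elt) :
    Inc Γ₂ (x.map (mapIndex ρ) (mapIndex_injective ρ.injective))
      (y.map (mapIndex ρ) (mapIndex_injective ρ.injective)) ↔ Inc Γ₁ x y := by
  have hi := mapIndex_injective ρ.injective
  cases x <;> cases y <;> simp only [Elt.map, Inc, hi.eq_iff]
  case color.diag k e h =>
    induction e with
    | _ i j => simp [pairColor_map]
  case cell.diag i j h e h' =>
    rw [← Sym2.map_mk, (Sym2.map.injective hi).eq_iff]

theorem Elt.map_injective {σ : Index → Index} (hσ : Function.Injective σ) :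
    Function.Injective (Elt.map σ hσ) := by
  intro x y h
  cases x <;> cases y <;> simp_all [Elt.map, hσ.eq_iff, (Sym2.map.injective hσ).eq_iff]

/-- The embedding of partial planes induced by an embedding of graphs. -/
def graphEmb (ρ : Γ₁ ↪g Γ₂) : Emb (graphPlane Γ₁) (graphPlane Γ₂) where
  toFun := Elt.map (mapIndex ρ) (mapIndex_injective ρ.injective)
  injective := Elt.map_injective _
  side_eq x := by cases x <;> rfl
  adj_iff x y := or_congr (inc_map_iff ρ x y) (inc_map_iff ρ y x)

/-- A row, column or diagonal is determined by any of its cells, and two points of a diagonal always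
include a cell since it has only one colour. A cell is determined up to transposition by its
diagonal, or exactly by its row and column. In each case the indices involved lie in the range. -/
theorem graphEmb_isClosed (ρ : Γ₁ ↪g Γ₂) : (graphEmb ρ).IsClosed := by
  intro x y u hxy h1 h2
  have hi := mapIndex_injective ρ.injective
  cases u with
  | center => exact ⟨center, rfl⟩
  | color k => exact ⟨color k, rfl⟩
  | axis => exact ⟨axis, rfl⟩
  | row i =>
    cases x <;> cases y <;> simp [graphEmb, Elt.map, graphPlane_adj, Inc] at h1 h2 hxy
    all_goals first | exact ⟨row _, congrArg row h1.symm⟩ | exact ⟨row _, congrArg row h2.symm⟩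
  | col j =>
    cases x <;> cases y <;> simp [graphEmb, Elt.map, graphPlane_adj, Inc] at h1 h2 hxy
    exact ⟨col _, congrArg col h1.symm⟩
  | diag e h =>
    cases x <;> cases y <;> simp [graphEmb, Elt.map, graphPlane_adj, Inc] at h1 h2 hxy
    case color.color => exact (hxy (h1.symm.trans h2)).elim
    all_goals
      first
      | subst h1
        exact ⟨diag s(_, _) (by assumption), rfl⟩
      | subst h2
        exact ⟨diag s(_, _) (by assumption), rfl⟩
  | cell i j hij =>
    have key : (∃ i', mapIndex ρ i' = i) ∧ ∃ j', mapIndex ρ j' = j := by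
      have hd : ∀ e, Sym2.map (mapIndex ρ) e = s(i, j) →
          (∃ i', mapIndex ρ i' = i) ∧ ∃ j', mapIndex ρ j' = j := by
        intro e
        induction e with
        | _ a b =>
          rw [Sym2.map_mk, Sym2.eq_iff]
          rintro (⟨h, h'⟩ | ⟨h, h'⟩)
          exacts [⟨⟨a, h⟩, ⟨b, h'⟩⟩, ⟨⟨b, h'⟩, ⟨a, h⟩⟩]
      cases x <;> cases y <;> simp only [graphEmb, Elt.map, graphPlane_adj, Inc, or_false] at h1 h2
      case row.row => exact (hxy (congrArg row (hi (h1.symm.trans h2)))).elim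
      case col.col => exact (hxy (congrArg col (hi (h1.symm.trans h2)))).elim
      case row.col => exact ⟨⟨_, h1.symm⟩, ⟨_, h2.symm⟩⟩
      case col.row => exact ⟨⟨_, h2.symm⟩, ⟨_, h1.symm⟩⟩
      all_goals first | exact hd _ h1 | exact hd _ h2
    obtain ⟨⟨i', rfl⟩, ⟨j', rfl⟩⟩ := key
    exact ⟨cell i' j' (fun h => hij (congrArg _ h)), rfl⟩

/-! ### Rigidity: embeddings of these partial planes come from graphs -/

section Rigidity

variable (g : Emb (graphPlane Γ₁) (graphPlane Γ₂))

theorem infinite_row (i : Index) : {x | (graphPlane Γ₁).Adj (row i) x}.Infinite := by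
  refine Set.infinite_of_injective_forall_mem (f := fun n : ℕ => cell i (i.1 + n + 1, false)
    (fun h => by have := congrArg Prod.fst h; simp at this; omega)) (fun m n h => ?_) fun n => ?_
  · simpa using h
  · simp [graphPlane_adj, Inc]

theorem infinite_col (i : Index) : {x | (graphPlane Γ₁).Adj (col i) x}.Infinite := by
  refine Set.infinite_of_injective_forall_mem (f := fun n : ℕ => cell (i.1 + n + 1, false) i
    (fun h => by have := congrArg Prod.fst h; simp at this; omega)) (fun m n h => ?_) fun n => ?_
  · simpa using h
  · simp [graphPlane_adj, Inc]

theorem finite_axis : {x | (graphPlane Γ₁).Adj axis x}.Finite := by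
  refine ((Set.finite_singleton center).union (Set.finite_range color)).subset fun x hx => ?_
  cases x <;> simp_all [graphPlane_adj, Inc]

theorem finite_diag (e : Sym2 Index) (h : ¬ e.IsDiag) :
    {x | (graphPlane Γ₁).Adj (diag e h) x}.Finite := by
  induction e with
  | _ i j =>
    have hij : i ≠ j := by simpa using h
    refine ((Set.finite_range color).union (Set.toFinite {cell i j hij, cell j i hij.symm})).subset
      fun x hx => ?_
    cases x <;> simp_all [graphPlane_adj, Inc]
    exact hx.imp (fun h => ⟨h.1.symm, h.2.symm⟩) fun h => ⟨h.2.symm, h.1.symm⟩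

theorem Emb.infinite {l : Elt} (h : {x | (graphPlane Γ₁).Adj l x}.Infinite) :
    {x | (graphPlane Γ₂).Adj (g.toFun l) x}.Infinite := by
  refine (h.image g.injective.injOn).mono ?_
  rintro _ ⟨x, hx, rfl⟩
  exact (g.adj_iff _ _).2 hx

/-- Diagonals and `axis` have three points each; an embedding preserves having infinitely many
points, so this sends rows and columns to rows and columns. -/
theorem exists_of_infinite {l : Elt} (hs : isPoint l = false)
    (h : {x | (graphPlane Γ₁).Adj l x}.Infinite) : (∃ i, l = row i) ∨ ∃ i, l = col i := by
  cases l with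
  | center => simp [isPoint] at hs
  | color => simp [isPoint] at hs
  | cell => simp [isPoint] at hs
  | row i => exact Or.inl ⟨i, rfl⟩
  | col i => exact Or.inr ⟨i, rfl⟩
  | diag e he => exact (h (finite_diag e he)).elim
  | axis => exact (h finite_axis).elim

/-- `center` lies on infinitely many infinite lines, a cell on only two (its row and its column),
and a colour point on none. Three rows already rule out a cell. -/
theorem Emb.center_eq : g.toFun center = center := by
  have hs := g.side_eq center
  simp only [graphPlane_side] at hs
  have h : ∀ i, (∃ j, g.toFun (row i) = row j) ∨ ∃ j, g.toFun (row i) = col j := fun i =>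
    exists_of_infinite ((g.side_eq (row i)).trans rfl) (g.infinite (infinite_row i))
  have hadj : ∀ i, (graphPlane Γ₂).Adj (g.toFun center) (g.toFun (row i)) := fun i =>
    (g.adj_iff _ _).2 (Or.inl trivial)
  cases hc : g.toFun center with
  | center => rfl
  | color k =>
    have := hadj (0, false)
    rcases h (0, false) with ⟨j, hj⟩ | ⟨j, hj⟩ <;> simp [hc, hj, graphPlane_adj, Inc] at this
  | cell a b hab =>
    have key : ∀ i, g.toFun (row i) = row a ∨ g.toFun (row i) = col b := by
      intro i
      have := hadj i
      rcases h i with ⟨j, hj⟩ | ⟨j, hj⟩ <;> simp [hc, hj, graphPlane_adj, Inc] at this ⊢ <;>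
        exact this.symm
    have inj : ∀ m n : ℕ, g.toFun (row (m, false)) = g.toFun (row (n, false)) → m = n := by
      intro m n h
      simpa using g.injective h
    have h0 := key (0, false)
    have h1 := key (1, false)
    have h2 := key (2, false)
    have i0 := inj 0 1
    have i1 := inj 0 2
    have i2 := inj 1 2
    grind
  | row => simp [hc, isPoint] at hs
  | col => simp [hc, isPoint] at hs
  | diag => simp [hc, isPoint] at hs
  | axis => simp [hc, isPoint] at hs

theorem Emb.exists_row (i : Index) : ∃ j, g.toFun (row i) = row j := by
  rcases exists_of_infinite ((g.side_eq (row i)).trans rfl) (g.infinite (infinite_row i)) with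
    h | ⟨j, hj⟩
  · exact h
  · have := (g.adj_iff center (row i)).2 (Or.inl trivial)
    rw [g.center_eq, hj] at this
    simp [graphPlane_adj, Inc] at this

theorem Emb.exists_col (i : Index) : ∃ j, g.toFun (col i) = col j := by
  rcases exists_of_infinite ((g.side_eq (col i)).trans rfl) (g.infinite (infinite_col i)) with
    ⟨j, hj⟩ | h
  · have := (g.adj_iff center (col i)).1 (by
      rw [g.center_eq, hj]; exact Or.inl trivial)
    simp [graphPlane_adj, Inc] at this
  · exact h

/-- Embeddings of the partial planes of graphs act on the indices and on the colors. -/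
theorem Emb.exists_index_map : ∃ (σ : Index → Index) (hσ : Function.Injective σ)
    (π : Fin 3 → Fin 3), (∀ k, π k = 2 ↔ k = 2) ∧ Function.Injective π ∧
    (∀ k, g.toFun (color k) = color (π k)) ∧
    (∀ i j, i ≠ j → pairColor Γ₂ (σ i) (σ j) = π (pairColor Γ₁ i j)) ∧
    ∀ x, (∀ k, x ≠ color k) → g.toFun x = x.map σ hσ := by
  choose σ hσ using g.exists_row
  choose τ hτ using g.exists_col
  have σinj : Function.Injective σ := fun i j h => by
    have := g.injective ((hσ i).trans ((congrArg row h).trans (hσ j).symm))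
    simpa using this
  have hcell : ∀ i j h, ∃ h', g.toFun (cell i j h) = cell (σ i) (τ j) h' := by
    intro i j h
    have h1 := (g.adj_iff (cell i j h) (row i)).2 (Or.inl rfl)
    have h2 := (g.adj_iff (cell i j h) (col j)).2 (Or.inl rfl)
    rw [hσ] at h1
    rw [hτ] at h2
    cases hc : g.toFun (cell i j h) <;> simp [hc, graphPlane_adj, Inc] at h1 h2
    subst h1 h2
    exact ⟨_, rfl⟩
  -- The image line contains the cells (σ i, τ j) and (σ j, τ i), which share neither row nor
  -- column; `axis` contains no cells, so the image is a diagonal.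
  have hdiag : ∀ i j (h : i ≠ j), ∃ h', g.toFun (diag s(i, j) h) = diag s(σ i, τ j) h' ∧
      s(σ i, τ j) = s(σ j, τ i) := by
    intro i j h
    have h1 := (g.adj_iff (cell i j h) (diag s(i, j) h)).2 (Or.inl rfl)
    have h2 := (g.adj_iff (cell j i h.symm) (diag s(i, j) h)).2 (Or.inl Sym2.eq_swap)
    have hs := (g.side_eq (diag s(i, j) h)).trans rfl
    rw [graphPlane_side] at hs
    obtain ⟨h', hc⟩ := hcell i j h
    obtain ⟨h'', hc'⟩ := hcell j i h.symm
    rw [hc] at h1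
    rw [hc'] at h2
    cases hd : g.toFun (diag s(i, j) h) with
    | center => simp [hd, graphPlane_side, isPoint] at hs
    | color => simp [hd, graphPlane_side, isPoint] at hs
    | cell => simp [hd, graphPlane_side, isPoint] at hs
    | row k =>
      simp only [hd, graphPlane_adj, Inc, or_false] at h1 h2
      exact (h (σinj (h1.trans h2.symm))).elim
    | col k =>
      simp only [hd, graphPlane_adj, Inc, or_false] at h1 h2
      have := g.injective ((hτ i).trans ((congrArg col (h2.trans h1.symm)).trans (hτ j).symm))
      simp only [col.injEq] at this
      exact (h this).elim
    | diag e he =>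
      simp only [hd, graphPlane_adj, Inc, or_false] at h1 h2
      subst h1
      exact ⟨_, rfl, h2⟩
    | axis => simp [hd, graphPlane_adj, Inc] at h1
  -- The two cells on the image diagonal must be transposes of each other, as σ i ≠ σ j.
  have hτσ : τ = σ := by
    funext i
    have hne : i ≠ (i.1 + 1, i.2) := fun h => by simpa using congrArg Prod.fst h
    obtain ⟨-, -, h⟩ := hdiag _ _ hne
    rcases Sym2.eq_iff.1 h with h | h
    · exact (hne (σinj h.1)).elim
    · exact h.1.symm
  subst hτσ
  have hdiag' : ∀ i j (h : i ≠ j), ∃ h', g.toFun (diag s(i, j) h) = diag s(τ i, τ j) h' :=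
    fun i j h => ⟨_, (hdiag i j h).choose_spec.1⟩
  -- A cell lies on one diagonal and `center` on none, whereas the image of a colour point lies on
  -- two.
  have hcolor : ∀ k, ∃ k', g.toFun (color k) = color k' := by
    intro k
    have hs := (g.side_eq (color k)).trans rfl
    have hadj : ∀ i j (h : i ≠ j), pairColor Γ₁ i j = k →
        ∃ h', (graphPlane Γ₂).Adj (g.toFun (color k)) (diag s(τ i, τ j) h') := by
      intro i j h hk
      obtain ⟨h', hd⟩ := hdiag' i j h
      exact ⟨h', hd ▸ (g.adj_iff (color k) (diag s(i, j) h)).2 (Or.inl hk)⟩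
    obtain ⟨i, j, h, hk, i', j', h', hk', hne⟩ := exists_pairs_of_color Γ₁ k
    obtain ⟨d, h1⟩ := hadj i j h hk
    obtain ⟨d', h2⟩ := hadj i' j' h' hk'
    cases hc : g.toFun (color k) with
    | color k' => exact ⟨k', rfl⟩
    | cell a b hab =>
      simp only [hc, graphPlane_adj, Inc, or_false] at h1 h2
      exact (hne (Sym2.map.injective σinj (h1.trans h2.symm))).elim
    | center => simp [hc, graphPlane_adj, Inc] at h1
    | row | col | diag | axis => simp [hc, graphPlane_side, isPoint] at hs
  choose π hπ using hcolor
  -- `axis` is the only line through `center` that contains a colour point.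
  have haxis : g.toFun axis = axis := by
    have h1 := (g.adj_iff center axis).2 (Or.inl trivial)
    have h2 := (g.adj_iff (color 0) axis).2 (Or.inl (by simp [Inc]))
    rw [g.center_eq] at h1
    rw [hπ] at h2
    cases hc : g.toFun axis <;> simp_all [graphPlane_adj, Inc]
  refine ⟨τ, σinj, π, fun k => ?_, fun k k' h => ?_, hπ, fun i j h => ?_, fun x hx => ?_⟩
  · have := g.adj_iff (color k) axis
    rw [hπ, haxis] at this
    simpa [graphPlane_adj, Inc, not_iff_not] using this
  · have := g.injective ((hπ k).trans ((congrArg color h).trans (hπ k').symm))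
    simpa using this
  · obtain ⟨h', hd⟩ := hdiag' i j h
    have := (g.adj_iff (color (pairColor Γ₁ i j)) (diag s(i, j) h)).2 (Or.inl rfl)
    rw [hd, hπ] at this
    simpa [graphPlane_adj, Inc] using this
  · cases x with
    | center => exact g.center_eq
    | color k => exact (hx k rfl).elim
    | cell i j h => exact (hcell i j h).choose_spec
    | row i => exact hσ i
    | col i => exact hτ i
    | diag e h =>
      induction e with
      | _ i j => exact (hdiag' i j h).choose_spec
    | axis => exact haxis

/-- Embeddings of the partial planes of graphs come from embeddings of the graphs. -/
theorem Emb.exists_graphEmb : ∃ ρ : Γ₁ ↪g Γ₂, ∀ x, g.toFun x = (graphEmb ρ).toFun x := by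
  obtain ⟨σ, hσ, π, hπ2, hπ, hcolor, hpair, hrest⟩ := g.exists_index_map
  have htrue : ∀ u, (σ (u, true)).2 = true := by
    intro u
    have h := hpair (u, true) (u + 1, true) (by simp)
    rw [show pairColor Γ₁ (u, true) (u + 1, true) = 2 from rfl, (hπ2 2).2 rfl] at h
    exact (pairColor_eq_two_iff.1 h).1
  -- Otherwise the matched pair of `u`, of colour 0, would be sent to a pair of colour 2, which π
  -- does not allow.
  have hfalse : ∀ u, (σ (u, false)).2 = false := by
    intro u
    by_contra hu
    have h := hpair (u, false) (u, true) (by simp)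
    rw [pairColor_eq_two_iff.2 ⟨by simpa using hu, htrue u⟩, eq_comm, hπ2,
      pairColor_eq_two_iff] at h
    simp at h
  have hσf : ∀ u, σ (u, false) = ((σ (u, false)).1, false) := fun u => Prod.ext rfl (hfalse u)
  have hσt : ∀ u, σ (u, true) = ((σ (u, true)).1, true) := fun u => Prod.ext rfl (htrue u)
  have hpair' : ∀ u v, (if (σ (u, false)).1 = (σ (v, true)).1 then 0 else 1) =
      π (if u = v then 0 else 1) := by
    intro u v
    have h := hpair (u, false) (v, true) (by simp)
    rw [hσf, hσt] at h
    exact h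
  -- An index of the first kind has only one partner of colour 0 of the second kind, but two
  -- distinct partners of colour 1 (from vertices 1 and 2); so colour 1 cannot become colour 0.
  have hπ1 : π 1 = 1 := by
    have h1 := hpair' 0 1
    have h2 := hpair' 0 2
    simp only [zero_ne_one, OfNat.zero_ne_ofNat, if_false] at h1 h2
    have hne : (σ (1, true)).1 ≠ (σ (2, true)).1 := fun h => by
      have := hσ ((hσt 1).trans ((congrArg (·, true) h).trans (hσt 2).symm))
      simp at this
    split_ifs at h1 h2 with h3 h4
    · exact (hne (h3.symm.trans h4)).elim
    · exact h2.symm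
    all_goals exact h1.symm
  have hπ0 : π 0 = 0 := by
    have h1 : π 0 ≠ 1 := fun h => by simpa using hπ (h.trans hπ1.symm)
    have h2 : π 0 ≠ 2 := fun h => by simpa using (hπ2 0).1 h
    generalize π 0 = z at h1 h2
    revert z
    decide
  have hπid : ∀ k, π k = k := by
    intro k
    fin_cases k
    exacts [hπ0, hπ1, (hπ2 2).2 rfl]
  -- Preservation of colour 0 on matched pairs makes both indices of `u` move to the same vertex.
  have hft : ∀ u, (σ (u, true)).1 = (σ (u, false)).1 := by
    intro u
    have h := hpair' u u
    rw [hπid] at h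
    by_contra hne
    simp [Ne.symm hne] at h
  let ρ : Γ₁ ↪g Γ₂ :=
    { toFun := fun u => (σ (u, false)).1
      inj' := fun u v h => by
        have := hσ ((hσf u).trans ((congrArg (·, false) h).trans (hσf v).symm))
        simpa using this
      map_rel_iff' := fun {u v} => by
        by_cases huv : u = v
        · subst huv
          simp
        · have h := hpair (u, false) (v, false) (by simpa using huv)
          rw [hσf u, hσf v, hπid] at h
          rw [← pairColor_eq_zero_iff, ← pairColor_eq_zero_iff (Γ := Γ₁), ← h]
          rfl }
  have hσρ : σ = mapIndex ρ := by
    funext ⟨u, b⟩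
    cases b
    · exact hσf u
    · exact (hσt u).trans (congrArg (·, true) (hft u))
  clear_value ρ
  subst hσρ
  refine ⟨ρ, fun x => ?_⟩
  by_cases hx : ∃ k, x = color k
  · obtain ⟨k, rfl⟩ := hx
    rw [hcolor, hπid]
    rfl
  · exact hrest x (fun k hk => hx ⟨k, hk⟩)

end Rigidity

end GraphPlane

end PartialPlane

/-! ### Confined configurations and embeddings of the completed planes -/

namespace PartialPlane

open Elt

section Confined

/-- Both indices of a pair come from the first `n` vertices. -/
def BoundedPair (n : ℕ) (e : Sym2 Index) : Prop := ∀ i ∈ e, i.1 < n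

theorem boundedPair_mk {n : ℕ} {i j : Index} : BoundedPair n s(i, j) ↔ i.1 < n ∧ j.1 < n :=
  Sym2.ball

/-- A finite set of codes of elements all of whose indices are small. -/
def boundedTuples (n : ℕ) : Set (ℕ × Fin 3 × Index × Index × Sym2 Index) :=
  Set.Iio 7 ×ˢ Set.univ ×ˢ {i | i.1 < n} ×ˢ {i | i.1 < n} ×ˢ {e | BoundedPair n e}

theorem finite_boundedTuples (n : ℕ) : (boundedTuples n).Finite := by
  have h : {i : Index | i.1 < n}.Finite :=
    ((Set.finite_Iio n).prod Set.finite_univ).subset fun i hi => ⟨hi, trivial⟩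
  have h2 : {e : Sym2 Index | BoundedPair n e}.Finite := by
    refine ((h.prod h).image (fun p => s(p.1, p.2))).subset fun e he => ?_
    induction e with
    | _ i j => exact ⟨(i, j), ⟨he i (by simp), he j (by simp)⟩, rfl⟩
  exact (Set.finite_Iio 7).prod (Set.finite_univ.prod (h.prod (h.prod h2)))

/-- The elements whose indices come from the first `n` vertices. -/
def bounded (n : ℕ) : Set Elt := tuple ⁻¹' boundedTuples n

theorem finite_bounded (n : ℕ) : (bounded n).Finite :=
  (finite_boundedTuples n).preimage tuple_injective.injOn

theorem exists_mem_bounded (x : Elt) : ∃ n, 3 ≤ n ∧ x ∈ bounded n := by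
  have mem : ∀ n, 3 ≤ n → (∀ i ∈ [x.tuple.2.2.1, x.tuple.2.2.2.1], i.1 < n) →
      (∀ i ∈ x.tuple.2.2.2.2, i.1 < n) → x ∈ bounded n := by
    intro n hn h1 h2
    refine ⟨?_, trivial, h1 _ (by simp), h1 _ (by simp), h2⟩
    cases x <;> simp [tuple]
  generalize x.tuple.2.2.2.2 = e at mem
  induction e with
  | _ i j =>
    refine ⟨3 + x.tuple.2.2.1.1 + x.tuple.2.2.2.1.1 + i.1 + j.1, by omega, mem _ (by omega) ?_ ?_⟩
    all_goals
      simp only [List.mem_cons, List.not_mem_nil, or_false, Sym2.mem_iff]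
      rintro k (rfl | rfl) <;> omega

theorem exists_three_indices {n : ℕ} (hn : 3 ≤ n) {i : Index} (hi : i.1 < n) :
    ∃ j₁ j₂ j₃ : Index, j₁.1 < n ∧ j₂.1 < n ∧ j₃.1 < n ∧ i ≠ j₁ ∧ i ≠ j₂ ∧ i ≠ j₃ ∧
      j₁ ≠ j₂ ∧ j₁ ≠ j₃ ∧ j₂ ≠ j₃ := by
  obtain ⟨u, b⟩ := i
  by_cases hu : u = 0
  · refine ⟨(1, true), (1, false), (u, !b), ?_⟩
    simp_all
    omega
  · refine ⟨(0, true), (0, false), (u, !b), ?_⟩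
    simp_all
    omega

/-- Elements with three neighbours in a given set. -/
def HasThree {B : Type*} (P : PartialPlane B) (K : Set B) (x : B) : Prop :=
  ∃ y₁ ∈ K, ∃ y₂ ∈ K, ∃ y₃ ∈ K, y₁ ≠ y₂ ∧ y₁ ≠ y₃ ∧ y₂ ≠ y₃ ∧ P.Adj x y₁ ∧ P.Adj x y₂ ∧ P.Adj x y₃

variable {Γ : SimpleGraph ℕ}

/-- For colour points the diagonals are taken on vertices 0, 1 and 2, with at least one index of the
second kind, so that they serve for every graph. Cells, diagonals and `axis` find three neighbours
without any new vertex. -/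
theorem hasThree_bounded {n : ℕ} (hn : 3 ≤ n) {x : Elt} (hx : x ∈ bounded n) :
    HasThree (graphPlane Γ) (bounded n) x := by
  have h0 : 0 < n := by omega
  have h1 : 1 < n := by omega
  have h2 : 2 < n := by omega
  cases x with
  | center =>
    refine ⟨row (0, true), ?_, row (0, false), ?_, row (1, true), ?_, ?_⟩ <;>
      simp [bounded, boundedTuples, tuple, boundedPair_mk, graphPlane_adj, Inc, h0, h1]
  | color k =>
    fin_cases k
    · refine ⟨diag s((0, false), (0, true)) (by simp), ?_, diag s((1, false), (1, true)) (by simp),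
        ?_, diag s((2, false), (2, true)) (by simp), ?_, ?_⟩ <;>
      simp [bounded, boundedTuples, tuple, boundedPair_mk, graphPlane_adj, Inc, pairColor, h0, h1, h2]
    · refine ⟨diag s((0, false), (1, true)) (by simp), ?_, diag s((0, false), (2, true)) (by simp),
        ?_, diag s((1, false), (2, true)) (by simp), ?_, ?_⟩ <;>
      simp [bounded, boundedTuples, tuple, boundedPair_mk, graphPlane_adj, Inc, pairColor, h0, h1, h2]
    · refine ⟨diag s((0, true), (1, true)) (by simp), ?_, diag s((0, true), (2, true)) (by simp),
        ?_, diag s((1, true), (2, true)) (by simp), ?_, ?_⟩ <;>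
      simp [bounded, boundedTuples, tuple, boundedPair_mk, graphPlane_adj, Inc, pairColor, h0, h1, h2]
  | cell i j h =>
    refine ⟨row i, ?_, col j, ?_, diag s(i, j) h, ?_, ?_⟩ <;>
      simp_all [bounded, boundedTuples, tuple, boundedPair_mk, graphPlane_adj, Inc]
  | row i =>
    have hi : i.1 < n := hx.2.2.1
    obtain ⟨j₁, j₂, j₃, b₁, b₂, b₃, n₁, n₂, n₃, d₁, d₂, d₃⟩ := exists_three_indices hn hi
    refine ⟨cell i j₁ n₁, ?_, cell i j₂ n₂, ?_, cell i j₃ n₃, ?_, ?_⟩ <;>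
      simp_all [bounded, boundedTuples, tuple, boundedPair_mk, graphPlane_adj, Inc]
  | col i =>
    have hi : i.1 < n := hx.2.2.2.1
    obtain ⟨j₁, j₂, j₃, b₁, b₂, b₃, n₁, n₂, n₃, d₁, d₂, d₃⟩ := exists_three_indices hn hi
    refine ⟨cell j₁ i n₁.symm, ?_, cell j₂ i n₂.symm, ?_, cell j₃ i n₃.symm, ?_, ?_⟩ <;>
      simp_all [bounded, boundedTuples, tuple, boundedPair_mk, graphPlane_adj, Inc]
  | diag e h =>
    induction e with
    | _ i j =>
      have hij : i ≠ j := h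
      have hi : i.1 < n := (boundedPair_mk.1 hx.2.2.2.2).1
      have hj : j.1 < n := (boundedPair_mk.1 hx.2.2.2.2).2
      refine ⟨cell i j hij, ?_, cell j i hij.symm, ?_, color (pairColor Γ i j), ?_, ?_⟩ <;>
        simp_all [bounded, boundedTuples, tuple, boundedPair_mk, graphPlane_adj, Inc]
  | axis =>
    refine ⟨center, ?_, color 0, ?_, color 1, ?_, ?_⟩ <;>
      simp [bounded, boundedTuples, tuple, boundedPair_mk, graphPlane_adj, Inc, h0]

/-- The projective plane attached to a graph. -/
noncomputable abbrev freePlane (Γ : SimpleGraph ℕ) :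
    PartialPlane {t : Term Elt // (graphPlane Γ).Valid t} := (graphPlane Γ).free

instance : Fact (freePlane Γ).Complete := by
  refine ⟨free_complete (fun b => ?_) ⟨center, rfl⟩⟩
  obtain ⟨n, hn, hb⟩ := exists_mem_bounded b
  obtain ⟨y₁, -, y₂, -, -, -, hne, -, -, h1, h2, -⟩ := hasThree_bounded (Γ := Γ) hn hb
  exact ⟨y₁, y₂, hne, h1, h2⟩

variable {Γ₁ Γ₂ Γ₃ : SimpleGraph ℕ}

/-- The image of a finite configuration `bounded n` still has three neighbours at each element, so
it consists of base elements. Surjectivity of `f` plays no role. -/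
theorem Emb.exists_ofBase (f : Emb (freePlane Γ₁) (freePlane Γ₂)) (b : Elt) :
    ∃ c, f.toFun ((graphPlane Γ₁).ofBase b) = (graphPlane Γ₂).ofBase c := by
  obtain ⟨n, hn, hb⟩ := exists_mem_bounded b
  refine exists_base_of_confined
    (K := (fun x => f.toFun ((graphPlane Γ₁).ofBase x)) '' bounded n)
    ((finite_bounded n).image _) ?_ ⟨b, hb, rfl⟩
  rintro _ ⟨x, hx, rfl⟩
  obtain ⟨y₁, k₁, y₂, k₂, y₃, k₃, n₁, n₂, n₃, a₁, a₂, a₃⟩ := hasThree_bounded (Γ := Γ₁) hn hx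
  have hinj := f.injective.comp (ofBase_injective (P := graphPlane Γ₁))
  have hadj : ∀ y, (graphPlane Γ₁).Adj x y → (freePlane Γ₂).Adj
      (f.toFun ((graphPlane Γ₁).ofBase x)) (f.toFun ((graphPlane Γ₁).ofBase y)) :=
    fun y h => (f.adj_iff _ _).2 (free_adj_ofBase.2 h)
  exact ⟨_, ⟨y₁, k₁, rfl⟩, _, ⟨y₂, k₂, rfl⟩, _, ⟨y₃, k₃, rfl⟩, hinj.ne n₁, hinj.ne n₂, hinj.ne n₃,
    hadj _ a₁, hadj _ a₂, hadj _ a₃⟩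

/-- The embedding of projective planes induced by an embedding of graphs. -/
noncomputable def planeEmb (ρ : Γ₁ ↪g Γ₂) : Emb (freePlane Γ₁) (freePlane Γ₂) :=
  freeMap (graphEmb ρ) (graphEmb_isClosed ρ)

theorem planeEmb_ofBase (ρ : Γ₁ ↪g Γ₂) (b : Elt) :
    (planeEmb ρ).toFun ((graphPlane Γ₁).ofBase b) =
      (graphPlane Γ₂).ofBase ((graphEmb ρ).toFun b) := rfl

theorem Emb.exists_planeEmb (f : Emb (freePlane Γ₁) (freePlane Γ₂)) :
    ∃ ρ : Γ₁ ↪g Γ₂, f = planeEmb ρ := by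
  choose g hg using f.exists_ofBase
  obtain ⟨ρ, hρ⟩ := Emb.exists_graphEmb (Γ₁ := Γ₁) (Γ₂ := Γ₂)
    { toFun := g
      injective := fun x y h => ofBase_injective (P := graphPlane Γ₁)
        (f.injective ((hg x).trans ((congrArg _ h).trans (hg y).symm)))
      side_eq := fun x =>
        (congrArg (freePlane Γ₂).side (hg x)).symm.trans (f.side_eq ((graphPlane Γ₁).ofBase x))
      adj_iff := fun x y => by
        rw [← free_adj_ofBase (P := graphPlane Γ₂), ← hg, ← hg,
          ← free_adj_ofBase (P := graphPlane Γ₁)]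
        exact f.adj_iff _ _ }
  refine ⟨ρ, Emb.ext_base fun b => ?_⟩
  rw [hg, planeEmb_ofBase, ← hρ]

theorem planeEmb_injective : Function.Injective (planeEmb : (Γ₁ ↪g Γ₂) → _) := by
  intro ρ ρ' h
  ext u
  have := congrArg (fun f => f.toFun ((graphPlane Γ₁).ofBase (row (u, false)))) h
  simp only [planeEmb_ofBase] at this
  have := ofBase_injective (P := graphPlane Γ₂) this
  simpa [graphEmb, Elt.map, mapIndex] using this

theorem planeEmb_trans (ρ : Γ₁ ↪g Γ₂) (ρ' : Γ₂ ↪g Γ₃) :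
    (planeEmb ρ).trans (planeEmb ρ') = planeEmb (ρ'.comp ρ) := by
  refine Emb.ext_base fun b => congrArg (graphPlane Γ₃).ofBase ?_
  cases b <;> simp [graphEmb, Elt.map, mapIndex, Sym2.map_map]
  rfl

theorem planeEmb_refl : planeEmb (SimpleGraph.Embedding.refl (G := Γ)) = Emb.refl _ := by
  refine Emb.ext_base fun b => congrArg (graphPlane Γ).ofBase ?_
  cases b <;> simp [graphEmb, Elt.map, mapIndex]
  exact congrFun Sym2.map_id _

end Confined

end PartialPlane

/-! ### Failure of Desargues' theorem -/

namespace PartialPlane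

open Term

section Desargues

variable {B : Type*} {P : PartialPlane B}

theorem joined_base {b c : B} (h : P.Joined (base b) (base c)) :
    ∃ u, P.Adj u b ∧ P.Adj u c := by
  obtain ⟨u, h1, h2, h3⟩ := h
  rcases h1 with h1 | h1 | h1
  · exact h1.elim
  · rcases h2 with h2 | h2 | h2
    · exact h2.elim
    · exact (h3 ⟨h1, h2⟩).elim
    · obtain ⟨d, -, rfl, -, -⟩ := h2.exists
      exact h1.elim
  · obtain ⟨d, e, rfl, he, hd⟩ := h1.exists
    cases he
    exact ⟨d, hd, termAdj_base.1 (h2 : P.TermAdj (base d) (base c))⟩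

variable [Encodable B]

theorem adj_symJoin {u s t : Term B} : P.TermAdj u (symJoin s t) ↔ u = s ∨ u = t ∨ Child (symJoin s t) u := by
  have : ¬ P.BaseAdj u (symJoin s t) := fun h => by
    obtain ⟨-, c, -, h, -⟩ := h.exists
    rcases symJoin_eq_or s t with h' | h' <;> rw [h'] at h <;> cases h
  simp [TermAdj, this, child_symJoin, or_assoc]

theorem base_ne_symJoin {b : B} {s t : Term B} : base b ≠ symJoin s t := by
  rcases symJoin_eq_or s t with h | h <;> rw [h] <;> simp

theorem not_child_symJoin_base {s t : Term B} {b c : B} : ¬ Child (symJoin s t) (symJoin (base b) (base c)) := by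
  rw [child_symJoin]
  rintro (h | h) <;> exact base_ne_symJoin h.symm

theorem Lat.adj_of_le {E : Type*} {Q : PartialPlane E} {x y : E} (h : (Lat.el x : Lat Q) ≤ Lat.el y)
    (hx : Q.side x = true) (hy : Q.side y = false) : Q.Adj y x := by
  rcases h with rfl | ⟨-, h⟩
  · simp [hx] at hy
  · exact Q.symm h

/-- No two vertices of a triangle are joined in `P`, so the sides are formal lines, and
corresponding sides meet in formal points. A line through such a point is one of the two sides
defining it or has it as a child. A common line of the three points would thus be a join with three
distinct children. -/
theorem not_isDesarguesian_free [hP : Fact P.free.Complete] {o : B} {m a b : Fin 3 → B}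
    (ho : P.side o = true) (hm : Function.Injective m) (ha : Function.Injective a)
    (hb : Function.Injective b) (hab : ∀ i j, a i ≠ b j) (hao : ∀ i, a i ≠ o)
    (hbo : ∀ i, b i ≠ o) (hmo : ∀ i, P.Adj (m i) o) (hma : ∀ i, P.Adj (m i) (a i))
    (hmb : ∀ i, P.Adj (m i) (b i)) (hna : ∀ i j u, i ≠ j → P.Adj u (a i) → ¬ P.Adj u (a j))
    (hnb : ∀ i j u, i ≠ j → P.Adj u (b i) → ¬ P.Adj u (b j)) :
    ¬ IsDesarguesian (Lat P.free) := by
  have sm : ∀ i, P.side (m i) = false := fun i => Lat.side_of_adj (P.symm (hmo i)) ho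
  have sa : ∀ i, P.side (a i) = true := fun i => Lat.side_of_adj' (hma i) (sm i)
  have sb : ∀ i, P.side (b i) = true := fun i => Lat.side_of_adj' (hmb i) (sm i)
  have vA : ∀ i j, i ≠ j → P.Valid (symJoin (base (a i)) (base (a j))) := fun i j hij =>
    Valid.mk trivial trivial (fun h => hij (ha (Term.base.inj h)))
      ((sa i).trans (sa j).symm) fun h => by
        obtain ⟨u, h1, h2⟩ := joined_base h
        exact hna i j u hij h1 h2
  have vB : ∀ i j, i ≠ j → P.Valid (symJoin (base (b i)) (base (b j))) := fun i j hij =>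
    Valid.mk trivial trivial (fun h => hij (hb (Term.base.inj h)))
      ((sb i).trans (sb j).symm) fun h => by
        obtain ⟨u, h1, h2⟩ := joined_base h
        exact hnb i j u hij h1 h2
  have adjl : ∀ s t : Term B, P.TermAdj (symJoin s t) s := fun s t =>
    (adj_symJoin.2 (Or.inl rfl) : P.TermAdj s (symJoin s t)).symm
  have adjr : ∀ s t : Term B, P.TermAdj (symJoin s t) t := fun s t =>
    (adj_symJoin.2 (Or.inr (Or.inl rfl)) : P.TermAdj t (symJoin s t)).symm
  have sA : ∀ i j (hij : i ≠ j), P.free.side ⟨_, vA i j hij⟩ = false := fun i j hij =>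
    Lat.side_of_adj (Q := P.free) (x := P.ofBase (a i)) (adjl _ _).symm (sa i)
  have sB : ∀ i j (hij : i ≠ j), P.free.side ⟨_, vB i j hij⟩ = false := fun i j hij =>
    Lat.side_of_adj (Q := P.free) (x := P.ofBase (b i)) (adjl _ _).symm (sb i)
  have hAB : ∀ i j k l, symJoin (base (a i)) (base (a j)) ≠ symJoin (base (b k)) (base (b l)) := by
    intro i j k l h
    rcases symJoin_inj h with ⟨h, -⟩ | ⟨h, -⟩ <;> exact hab _ _ (Term.base.inj h)
  have vC : ∀ i j, i ≠ j →
      P.Valid (symJoin (symJoin (base (a i)) (base (a j))) (symJoin (base (b i)) (base (b j)))) := by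
    intro i j hij
    refine Valid.mk (vA i j hij) (vB i j hij) (hAB _ _ _ _)
      ((sA i j hij).trans (sB i j hij).symm) ?_
    rintro ⟨u, h1, h2, h3⟩
    rw [adj_symJoin] at h1 h2
    rcases h1 with rfl | rfl | h1 <;> rcases h2 with h2 | h2 | h2
    · exact hab _ _ (Term.base.inj h2)
    · exact hab _ _ (Term.base.inj h2)
    · exact h2
    · exact hab _ _ (Term.base.inj h2)
    · exact hab _ _ (Term.base.inj h2)
    · exact h2
    · subst h2; exact h1
    · subst h2; exact h1
    · exact h3 ⟨h1, h2⟩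
  have hsupA : ∀ i j (hij : i ≠ j), (Lat.el (P.ofBase (a i)) : Lat P.free) ⊔
      Lat.el (P.ofBase (a j)) = Lat.el ⟨_, vA i j hij⟩ := fun i j hij =>
    Lat.sup_points (ofBase_injective.ne (ha.ne hij)) (sa i) (adjl _ _) (adjr _ _)
  have hsupB : ∀ i j (hij : i ≠ j), (Lat.el (P.ofBase (b i)) : Lat P.free) ⊔
      Lat.el (P.ofBase (b j)) = Lat.el ⟨_, vB i j hij⟩ := fun i j hij =>
    Lat.sup_points (ofBase_injective.ne (hb.ne hij)) (sb i) (adjl _ _) (adjr _ _)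
  have hinf : ∀ i j (hij : i ≠ j), (Lat.el ⟨_, vA i j hij⟩ : Lat P.free) ⊓
      Lat.el ⟨_, vB i j hij⟩ = Lat.el ⟨_, vC i j hij⟩ := fun i j hij =>
    Lat.inf_lines (fun h => hAB _ _ _ _ (congrArg Subtype.val h)) (sA i j hij) (adjl _ _)
      (adjr _ _)
  have hline : ∀ c : Fin 3 → B, Function.Injective c → (∀ i, P.side (c i) = true) →
      (∀ i j, i ≠ j → P.Valid (symJoin (base (c i)) (base (c j)))) →
      ¬ LiesOnLine (Lat.el (P.ofBase (c 0)) : Lat P.free) (Lat.el (P.ofBase (c 1)))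
        (Lat.el (P.ofBase (c 2))) := by
    rintro c hc sc vc ⟨l, hl, h0, h1, h2⟩
    obtain ⟨x, hx, rfl⟩ := Lat.exists_of_isCoatom hP.out hl
    have h0 := Lat.adj_of_le h0 (sc 0) hx
    have h1 := Lat.adj_of_le h1 (sc 1) hx
    have h2 := Lat.adj_of_le h2 (sc 2) hx
    have e1 := (P.free.unique h0 h1 (v := ⟨_, vc 0 1 (by simp)⟩) (adjl _ _)
      (adjr _ _)).resolve_left (ofBase_injective.ne (hc.ne (by simp)))
    have e2 := (P.free.unique h0 h2 (v := ⟨_, vc 0 2 (by simp)⟩) (adjl _ _)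
      (adjr _ _)).resolve_left (ofBase_injective.ne (hc.ne (by simp)))
    rcases symJoin_inj (congrArg Subtype.val (e1.symm.trans e2)) with ⟨-, h⟩ | ⟨h, -⟩
    all_goals exact absurd (hc (Term.base.inj h)) (by simp)
  intro hD
  have hpersp : CentrallyPerspective (Lat.el (P.ofBase o) : Lat P.free)
      (fun i => Lat.el (P.ofBase (a i))) (fun i => Lat.el (P.ofBase (b i))) :=
    { atom_center := Lat.isAtom_el ho
      atom_left := fun i => Lat.isAtom_el (sa i)
      atom_right := fun i => Lat.isAtom_el (sb i)
      triangle_left := hline a ha sa vA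
      triangle_right := hline b hb sb vB
      ne_left := fun i h => hao i (ofBase_injective (Lat.el.inj h))
      ne_right := fun i h => hbo i (ofBase_injective (Lat.el.inj h))
      ne := fun i h => hab i i (ofBase_injective (Lat.el.inj h))
      collinear := fun i => ⟨Lat.el (P.ofBase (m i)), Lat.isCoatom_el (sm i),
        Or.inr ⟨ho, termAdj_base.2 (P.symm (hmo i))⟩,
        Or.inr ⟨sa i, termAdj_base.2 (P.symm (hma i))⟩,
        Or.inr ⟨sb i, termAdj_base.2 (P.symm (hmb i))⟩⟩
      lines_ne := fun i j hij => by
        have : ∀ k, (Lat.el (P.ofBase o) : Lat P.free) ⊔ Lat.el (P.ofBase (a k)) =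
            Lat.el (P.ofBase (m k)) := fun k =>
          Lat.sup_points (ofBase_injective.ne (hao k).symm) ho (termAdj_base.2 (hmo k))
            (termAdj_base.2 (hma k))
        rw [this, this]
        exact fun h => hij (hm (ofBase_injective (Lat.el.inj h))) }
  obtain ⟨l, hl, h01, h02, h12⟩ := hD _ _ _ hpersp
  obtain ⟨⟨x, vx⟩, hx, rfl⟩ := Lat.exists_of_isCoatom hP.out hl
  rw [hsupA 0 1 (by simp), hsupB 0 1 (by simp), hinf 0 1 (by simp)] at h01
  rw [hsupA 0 2 (by simp), hsupB 0 2 (by simp), hinf 0 2 (by simp)] at h02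
  rw [hsupA 1 2 (by simp), hsupB 1 2 (by simp), hinf 1 2 (by simp)] at h12
  have sC : ∀ i j (hij : i ≠ j), P.free.side ⟨_, vC i j hij⟩ = true := fun i j hij =>
    Lat.side_of_adj' (Q := P.free) (x := ⟨_, vA i j hij⟩) (adjl _ _).symm (sA i j hij)
  have h01 : P.TermAdj x _ := Lat.adj_of_le h01 (sC 0 1 (by simp)) hx
  have h02 : P.TermAdj x _ := Lat.adj_of_le h02 (sC 0 2 (by simp)) hx
  have h12 : P.TermAdj x _ := Lat.adj_of_le h12 (sC 1 2 (by simp)) hx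
  rw [adj_symJoin] at h01 h02 h12
  have neA : ∀ i j k l, s(i, j) ≠ s(k, l) →
      symJoin (base (a i)) (base (a j)) ≠ symJoin (base (a k)) (base (a l)) := by
    intro i j k l hne h
    rcases symJoin_inj h with ⟨h, h'⟩ | ⟨h, h'⟩ <;>
      rw [ha (Term.base.inj h), ha (Term.base.inj h')] at hne
    exacts [hne rfl, hne Sym2.eq_swap]
  have neB : ∀ i j k l, s(i, j) ≠ s(k, l) →
      symJoin (base (b i)) (base (b j)) ≠ symJoin (base (b k)) (base (b l)) := by
    intro i j k l hne h
    rcases symJoin_inj h with ⟨h, h'⟩ | ⟨h, h'⟩ <;>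
      rw [hb (Term.base.inj h), hb (Term.base.inj h')] at hne
    exacts [hne rfl, hne Sym2.eq_swap]
  have neC : ∀ i j k l, s(i, j) ≠ s(k, l) →
      symJoin (symJoin (base (a i)) (base (a j))) (symJoin (base (b i)) (base (b j))) ≠
        symJoin (symJoin (base (a k)) (base (a l))) (symJoin (base (b k)) (base (b l))) := by
    intro i j k l hne h
    rcases symJoin_inj h with ⟨h, -⟩ | ⟨h, -⟩
    exacts [neA _ _ _ _ hne h, hAB _ _ _ _ h]
  -- A line through one of the three intersection points is not a side defining another: sides for
  -- different pairs differ, and the children of a side are base elements.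
  have step : ∀ i j k l, s(i, j) ≠ s(k, l) →
      (x = symJoin (base (a k)) (base (a l)) ∨ x = symJoin (base (b k)) (base (b l)) ∨
        Child (symJoin (symJoin (base (a k)) (base (a l))) (symJoin (base (b k)) (base (b l)))) x) →
      x ≠ symJoin (base (a i)) (base (a j)) ∧ x ≠ symJoin (base (b i)) (base (b j)) := by
    rintro i j k l hne h
    constructor <;> rintro rfl
    · rcases h with h | h | h
      exacts [neA _ _ _ _ hne h, hAB _ _ _ _ h, not_child_symJoin_base h]
    · rcases h with h | h | h
      exacts [hAB _ _ _ _ h.symm, neB _ _ _ _ hne h, not_child_symJoin_base h]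
  have n1 := step 0 1 0 2 (by decide) h02
  have n2 := step 0 2 0 1 (by decide) h01
  have n3 := step 1 2 0 1 (by decide) h01
  have c1 := (h01.resolve_left n1.1).resolve_left n1.2
  have c2 := (h02.resolve_left n2.1).resolve_left n2.2
  have c3 := (h12.resolve_left n3.1).resolve_left n3.2
  have d1 := neC 0 1 0 2 (by decide)
  have d2 := neC 0 1 1 2 (by decide)
  have d3 := neC 0 2 1 2 (by decide)
  cases x with
  | base => exact c1
  | join s t =>
    rcases c1 with c1 | c1 <;> rcases c2 with c2 | c2 <;> rcases c3 with c3 | c3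
    all_goals first
      | exact d1 (c1.trans c2.symm)
      | exact d2 (c1.trans c3.symm)
      | exact d3 (c2.trans c3.symm)

end Desargues

theorem not_isDesarguesian_freePlane (Γ : SimpleGraph ℕ) : ¬ IsDesarguesian (Lat (freePlane Γ)) := by
  have hne : ∀ i n : ℕ, n ≠ 0 → (⟨i, false⟩ : Index) ≠ (i + n, false) := by simp
  have nadj : ∀ n (hn : n ≠ 0) (i j : Fin 3) (u : Elt), i ≠ j →
      (graphPlane Γ).Adj u (Elt.cell _ _ (hne i n hn)) →
      ¬ (graphPlane Γ).Adj u (Elt.cell _ _ (hne j n hn)) := by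
    intro n hn i j u hij h1 h2
    have hij' : (i : ℕ) ≠ j := fun h => hij (Fin.ext h)
    cases u <;> simp only [graphPlane_adj, Inc, or_false, false_or] at h1 h2
    case row => exact hij' (by simpa using h1.trans h2.symm)
    case col => exact hij' (by simpa using h1.trans h2.symm)
    case diag =>
      have := h1.symm.trans h2
      simp only [Sym2.eq_iff, Prod.mk.injEq] at this
      omega
  -- The vertices are the cells (i, i + 3) and (i, i + 6) on three rows through `center`. A constant
  -- nonzero offset keeps cells of one triangle off common rows, columns and diagonals; distinct
  -- offsets separate the triangles.
  refine not_isDesarguesian_free (o := Elt.center) (m := fun i => Elt.row (i, false))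
    (a := fun i => Elt.cell _ _ (hne i 3 (by simp))) (b := fun i => Elt.cell _ _ (hne i 6 (by simp)))
    rfl ?_ ?_ ?_ ?_ ?_ ?_ ?_ ?_ ?_ ?_ ?_
  · exact fun i j h => Fin.ext (by simpa using h)
  · exact fun i j h => Fin.ext (by simpa using h)
  · exact fun i j h => Fin.ext (by simpa using h)
  · intro i j h
    simp at h
    omega
  · simp
  · simp
  · simp [graphPlane_adj, Inc]
  · simp [graphPlane_adj, Inc]
  · simp [graphPlane_adj, Inc]
  · exact fun i j u => nadj 3 (by simp) i j u
  · exact fun i j u => nadj 6 (by simp) i j u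

end PartialPlane

/-! ### Borel enumeration of infinite sets of natural numbers -/

section Enumeration

variable {α : Type*} [MeasurableSpace α]

open scoped Classical in
theorem measurable_count_eq {S : α → ℕ → Prop} (hS : ∀ k, Measurable fun a => S a k) (k n : ℕ) :
    Measurable fun a => Nat.count (S a) k = n := by
  induction k generalizing n with
  | zero => simp
  | succ k ih =>
    have : (fun a => Nat.count (S a) (k + 1) = n) = fun a =>
        (S a k ∧ ∃ m, n = m + 1 ∧ Nat.count (S a) k = m) ∨ (¬ S a k ∧ Nat.count (S a) k = n) := by
      funext a
      rw [Nat.count_succ]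
      by_cases h : S a k <;> simp [h, eq_comm]
    rw [this]
    exact ((hS k).and (Measurable.exists fun m => measurable_const.and (ih m))).or
      ((hS k).not.and (ih n))

open scoped Classical in
theorem measurable_nth_eq {S : α → ℕ → Prop} (hS : ∀ k, Measurable fun a => S a k)
    (hinf : ∀ a, {k | S a k}.Infinite) (k n : ℕ) : Measurable fun a => Nat.nth (S a) n = k := by
  have : (fun a => Nat.nth (S a) n = k) = fun a => S a k ∧ Nat.count (S a) k = n := by
    funext a
    refine propext ⟨?_, ?_⟩
    · rintro rfl
      exact ⟨Nat.nth_mem_of_infinite (hinf a) n, Nat.count_nth_of_infinite (hinf a) n⟩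
    · rintro ⟨h, rfl⟩
      exact Nat.nth_count h
  rw [this]
  exact (hS k).and (measurable_count_eq hS k n)

end Enumeration

/-- Conjugation by an order isomorphism. -/
def OrderIso.conjAut {α β : Type*} [LE α] [LE β] (e : α ≃o β) : (α ≃o α) ≃* (β ≃o β) where
  toFun f := (e.symm.trans f).trans e
  invFun f := (e.trans f).trans e.symm
  left_inv f := by ext; simp
  right_inv f := by ext; simp
  map_mul' f g := by ext; simp

/-! ### Borel coding of the plane on the natural numbers -/

namespace PartialPlane

open Term

section Measurability

theorem measurable_pairColor (i j : Index) (k : Fin 3) :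
    Measurable fun Γ : XGr => pairColor Γ i j = k := by
  have h : ∀ u v, Measurable fun Γ : XGr => Γ.Adj u v :=
    SimpleGraph.measurable_iff_adj.1 measurable_id
  have aux : ∀ u v, (fun Γ : XGr => pairColor Γ (u, false) (v, false) = k) =
      fun Γ => (Γ.Adj u v ∧ 0 = k) ∨ (¬ Γ.Adj u v ∧ 1 = k) := by
    intro u v
    funext Γ
    by_cases h : Γ.Adj u v <;> simp [pairColor, h]
  rcases i with ⟨u, _ | _⟩ <;> rcases j with ⟨v, _ | _⟩
  · rw [aux]
    exact ((h u v).and measurable_const).or ((h u v).not.and measurable_const)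
  all_goals
    simp only [pairColor]
    exact measurable_const

theorem measurable_inc (x y : Elt) : Measurable fun Γ : XGr => Inc Γ x y := by
  cases x <;> cases y
  case color.diag k e h =>
    induction e with
    | _ i j => exact measurable_pairColor i j k
  all_goals exact measurable_const

theorem measurable_termAdj (x y : Term Elt) :
    Measurable fun Γ : XGr => (graphPlane Γ).TermAdj x y := by
  refine measurable_const.or (measurable_const.or ?_)
  cases x with
  | base b =>
    cases y with
    | base c => exact (measurable_inc b c).or (measurable_inc c b)
    | join => exact measurable_const
  | join => cases y <;> exact measurable_const

theorem termSide_graphPlane (Γ₁ Γ₂ : XGr) (t : Term Elt) :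
    (graphPlane Γ₁).termSide t = (graphPlane Γ₂).termSide t := by
  induction t with
  | base b => rfl
  | join s t hs _ => simp only [termSide, hs]

theorem measurable_termSide (s : Term Elt) (p : Bool → Prop) :
    Measurable fun Γ : XGr => p ((graphPlane Γ).termSide s) := by
  simp only [fun Γ : XGr => termSide_graphPlane Γ ⊥ s]
  exact measurable_const

/-- The terms are the same for all graphs and countable in number, so the quantifier in `Joined` is
a countable union. -/
theorem measurable_valid (t : Term Elt) : Measurable fun Γ : XGr => (graphPlane Γ).Valid t := by
  induction t with
  | base b => exact measurable_const
  | join s t hs ht =>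
    refine measurable_const.and (hs.and (ht.and (Measurable.and ?_ (Measurable.not ?_))))
    · simp only [fun Γ : XGr => termSide_graphPlane Γ ⊥ s,
        fun Γ : XGr => termSide_graphPlane Γ ⊥ t]
      exact measurable_const
    · exact Measurable.exists fun u =>
        (measurable_termAdj u s).and ((measurable_termAdj u t).and measurable_const)

end Measurability

section Coding

/-- The codes of the elements of the projective plane of a graph. -/
def IsCode (Γ : XGr) (k : ℕ) : Prop := ∃ t, (graphPlane Γ).Valid t ∧ t.code = k

theorem infinite_isCode (Γ : XGr) : {k | IsCode Γ k}.Infinite :=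
  Set.infinite_of_injective_forall_mem
    (f := fun n : ℕ => (base (Elt.row (n, false))).code)
    (fun m n h => by simpa using code_injective h)
    fun n => ⟨base (Elt.row (n, false)), trivial, rfl⟩

theorem measurable_isCode (k : ℕ) : Measurable fun Γ : XGr => IsCode Γ k :=
  Measurable.exists fun t => (measurable_valid t).and measurable_const

/-- The enumeration of the projective plane of a graph in the order of the codes. -/
noncomputable def enum (Γ : XGr) (n : ℕ) : {t : Term Elt // (graphPlane Γ).Valid t} :=
  ⟨_, (Nat.nth_mem_of_infinite (infinite_isCode Γ) n).choose_spec.1⟩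

theorem code_enum (Γ : XGr) (n : ℕ) : (enum Γ n).1.code = Nat.nth (IsCode Γ) n :=
  (Nat.nth_mem_of_infinite (infinite_isCode Γ) n).choose_spec.2

theorem enum_bijective (Γ : XGr) : Function.Bijective (enum Γ) := by
  constructor
  · intro m n h
    apply Nat.nth_injective (infinite_isCode Γ)
    rw [← code_enum, ← code_enum, h]
  · intro t
    have h : t.1.code ∈ Set.range (Nat.nth (IsCode Γ)) := by
      rw [Nat.range_nth_of_infinite (infinite_isCode Γ)]
      exact ⟨t.1, t.2, rfl⟩
    obtain ⟨n, hn⟩ := h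
    exact ⟨n, Subtype.ext (code_injective ((code_enum Γ n).trans hn))⟩

theorem measurable_enum (n : ℕ) (t : Term Elt) : Measurable fun Γ : XGr => (enum Γ n).1 = t := by
  simp only [← code_injective.eq_iff (α := Term Elt), code_enum]
  exact measurable_nth_eq measurable_isCode infinite_isCode _ n

/-- The enumeration of the lattice of flats. -/
noncomputable def enumLat (Γ : XGr) : ℕ → Lat (freePlane Γ)
  | 0 => Lat.bot
  | 1 => Lat.top
  | n + 2 => Lat.el (enum Γ n)

theorem enumLat_bijective (Γ : XGr) : Function.Bijective (enumLat Γ) := by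
  constructor
  · intro m n h
    rcases m with _ | _ | m <;> rcases n with _ | _ | n <;> simp [enumLat] at h ⊢
    exact (enum_bijective Γ).1 h
  · intro x
    rcases x with _ | x | _
    · exact ⟨0, rfl⟩
    · obtain ⟨n, rfl⟩ := (enum_bijective Γ).2 x
      exact ⟨n + 2, rfl⟩
    · exact ⟨1, rfl⟩

theorem measurable_enumLat_le (m n : ℕ) :
    Measurable fun Γ : XGr => enumLat Γ m ≤ enumLat Γ n := by
  -- Splitting over the countably many values of the two enumerated terms reduces the order to
  -- incidence of fixed terms.
  have hel : ∀ m n, (fun Γ : XGr => enumLat Γ (m + 2) ≤ enumLat Γ (n + 2)) = fun Γ : XGr =>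
      ∃ s t, (enum Γ m).1 = s ∧ (enum Γ n).1 = t ∧
        (s = t ∨ ((graphPlane Γ).termSide s = true ∧ (graphPlane Γ).TermAdj s t)) := by
    intro m n
    funext Γ
    simp only [↓existsAndEq, true_and, enumLat, Lat.el_le_el, Subtype.ext_iff]
    rfl
  rcases m with _ | _ | m <;> rcases n with _ | _ | n
  case succ.succ.succ.succ =>
    rw [hel]
    exact Measurable.exists fun s => Measurable.exists fun t => (measurable_enum m s).and
      ((measurable_enum n t).and (measurable_const.or ((measurable_termSide s (· = true)).and
        (measurable_termAdj s t))))
  all_goals exact measurable_const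

/-- The natural numbers, as codes of the elements of the lattice of flats. -/
def Coded (_Γ : XGr) : Type := ℕ

/-- The equivalence of the codes with the lattice of flats. -/
noncomputable def codedEquiv (Γ : XGr) : Coded Γ ≃ Lat (freePlane Γ) :=
  Equiv.ofBijective _ (enumLat_bijective Γ)

noncomputable instance Coded.instLattice (Γ : XGr) : Lattice (Coded Γ) where
  le m n := codedEquiv Γ m ≤ codedEquiv Γ n
  le_refl _ := le_rfl
  le_trans _ _ _ := le_trans
  le_antisymm _ _ h h' := (codedEquiv Γ).injective (le_antisymm h h')
  sup m n := (codedEquiv Γ).symm (codedEquiv Γ m ⊔ codedEquiv Γ n)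
  inf m n := (codedEquiv Γ).symm (codedEquiv Γ m ⊓ codedEquiv Γ n)
  le_sup_left _ _ := by simp
  le_sup_right _ _ := by simp
  sup_le _ _ _ h h' := by simp [h, h']
  inf_le_left _ _ := by simp
  inf_le_right _ _ := by simp
  le_inf _ _ _ h h' := by simp [h, h']

noncomputable instance Coded.instBoundedOrder (Γ : XGr) : BoundedOrder (Coded Γ) where
  bot := (0 : ℕ)
  bot_le _ := Lat.bot_le' _
  top := (1 : ℕ)
  le_top _ := Lat.le_top' _

/-- The lattice of codes is isomorphic to the lattice of flats. -/
noncomputable def codedIso (Γ : XGr) : Coded Γ ≃o Lat (freePlane Γ) where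
  toEquiv := codedEquiv Γ
  map_rel_iff' := Iff.rfl

/-- The coded projective plane of a graph. -/
noncomputable def codedPlane (Γ : XGr) : XPpl where
  lattice := Coded.instLattice Γ
  bounded := Coded.instBoundedOrder Γ
  isPlane := IsPlane.of_orderIso (α := Coded Γ) (codedIso Γ) Lat.isPlane
  isProjective := IsProjective.of_orderIso (α := Coded Γ) (codedIso Γ) Lat.isProjective
  not_isDesarguesian h := not_isDesarguesian_freePlane Γ
    (IsDesarguesian.of_orderIso (β := Coded Γ) (codedIso Γ).symm h)

/-- The carrier of the coded plane is isomorphic to the lattice of flats. -/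
noncomputable def carrierIso (Γ : XGr) : (codedPlane Γ).Carrier ≃o Lat (freePlane Γ) := codedIso Γ

/-- Suprema and infima are defined from the order by formulas with quantifiers over the naturals, so
it is enough that the coded order is Borel in the graph. -/
theorem measurable_codedPlane : Measurable codedPlane := by
  have hle := measurable_enumLat_le
  rw [measurable_comap_iff]
  have hsup : ∀ m n k : ℕ, Measurable fun Γ : XGr => (max m n : Coded Γ) = k := by
    intro m n k
    have : (fun Γ : XGr => (max m n : Coded Γ) = k) = fun Γ =>
        enumLat Γ m ≤ enumLat Γ k ∧ enumLat Γ n ≤ enumLat Γ k ∧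
          ∀ j, enumLat Γ m ≤ enumLat Γ j → enumLat Γ n ≤ enumLat Γ j →
            enumLat Γ k ≤ enumLat Γ j := by
      funext Γ
      refine propext ⟨?_, fun ⟨h1, h2, h3⟩ => ?_⟩
      · rintro rfl
        exact ⟨le_sup_left (α := Coded Γ), le_sup_right (α := Coded Γ), fun j h h' => sup_le (α := Coded Γ) h h'⟩
      · exact le_antisymm (α := Coded Γ) (sup_le (α := Coded Γ) h1 h2)
          (h3 _ (le_sup_left (α := Coded Γ)) (le_sup_right (α := Coded Γ)))
    rw [this]
    exact (hle _ _).and ((hle _ _).and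
      (Measurable.forall fun j => (hle _ _).imp ((hle _ _).imp (hle _ _))))
  have hinf : ∀ m n k : ℕ, Measurable fun Γ : XGr => (min m n : Coded Γ) = k := by
    intro m n k
    have : (fun Γ : XGr => (min m n : Coded Γ) = k) = fun Γ =>
        enumLat Γ k ≤ enumLat Γ m ∧ enumLat Γ k ≤ enumLat Γ n ∧
          ∀ j, enumLat Γ j ≤ enumLat Γ m → enumLat Γ j ≤ enumLat Γ n →
            enumLat Γ j ≤ enumLat Γ k := by
      funext Γ
      refine propext ⟨?_, fun ⟨h1, h2, h3⟩ => ?_⟩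
      · rintro rfl
        exact ⟨inf_le_left (α := Coded Γ), inf_le_right (α := Coded Γ), fun j h h' => le_inf (α := Coded Γ) h h'⟩
      · exact le_antisymm (α := Coded Γ) (h3 _ (inf_le_left (α := Coded Γ)) (inf_le_right (α := Coded Γ)))
          (le_inf (α := Coded Γ) h1 h2)
    rw [this]
    exact (hle _ _).and ((hle _ _).and
      (Measurable.forall fun j => (hle _ _).imp ((hle _ _).imp (hle _ _))))
  have hnat : ∀ f : XGr → ℕ, (∀ k, Measurable fun Γ => f Γ = k) → Measurable f := fun f hf =>
    measurable_to_countable' fun k => measurableSet_setOfPred.2 (hf k)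
  change Measurable fun Γ : XGr => ((0, 1, fun p => (max p.1 p.2 : Coded Γ),
    fun p => (min p.1 p.2 : Coded Γ)) : ℕ × ℕ × (ℕ × ℕ → ℕ) × (ℕ × ℕ → ℕ))
  refine measurable_const.prodMk (measurable_const.prodMk (Measurable.prodMk ?_ ?_))
  · exact measurable_pi_lambda _ fun p => hnat _ (hsup p.1 p.2)
  · exact measurable_pi_lambda _ fun p => hnat _ (hinf p.1 p.2)

end Coding

/-! ### The correspondence of embeddings and isomorphisms -/

section Functor

variable {Γ Γ₁ Γ₂ : XGr}

/-- The homomorphism of coded planes given by a homomorphism of lattices of flats. -/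
noncomputable def codedHom (φ : BoundedLatticeHom (Lat (freePlane Γ₁)) (Lat (freePlane Γ₂))) :
    BoundedLatticeHom (codedPlane Γ₁).Carrier (codedPlane Γ₂).Carrier :=
  ((carrierIso Γ₂).symm : BoundedLatticeHom _ _).comp
    (φ.comp (carrierIso Γ₁ : BoundedLatticeHom _ _))

theorem embeds_iff : Nonempty (Γ₁ ↪g Γ₂) ↔ (codedPlane Γ₁).Embeds (codedPlane Γ₂) := by
  constructor
  · rintro ⟨ρ⟩
    exact ⟨codedHom (Lat.mapHom (planeEmb ρ)), (carrierIso Γ₂).symm.injective.comp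
      ((Lat.map_injective _).comp (carrierIso Γ₁).injective)⟩
  · rintro ⟨φ, hφ⟩
    let ψ : BoundedLatticeHom (Lat (freePlane Γ₁)) (Lat (freePlane Γ₂)) :=
      (carrierIso Γ₂ : BoundedLatticeHom _ _).comp
        (φ.comp ((carrierIso Γ₁).symm : BoundedLatticeHom _ _))
    obtain ⟨f, -⟩ := Lat.exists_emb ψ ((carrierIso Γ₂).injective.comp
      (hφ.comp (carrierIso Γ₁).symm.injective))
    exact ⟨f.exists_planeEmb.choose⟩

theorem planeEmb_comp_apply {Γ₃ : XGr} (ρ : Γ₁ ↪g Γ₂) (ρ' : Γ₂ ↪g Γ₃) (x : _) :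
    (planeEmb ρ').toFun ((planeEmb ρ).toFun x) = (planeEmb (ρ'.comp ρ)).toFun x :=
  congrArg (fun f => f.toFun x) (planeEmb_trans ρ ρ')

theorem planeEmb_refl_apply (x : _) :
    (planeEmb (SimpleGraph.Embedding.refl (G := Γ))).toFun x = x :=
  congrArg (fun f => f.toFun x) planeEmb_refl

/-- The isomorphism of lattices of flats induced by an isomorphism of graphs. -/
noncomputable def latIso (ρ : Γ₁ ≃g Γ₂) : Lat (freePlane Γ₁) ≃o Lat (freePlane Γ₂) :=
  Lat.mapIso (planeEmb ρ.toEmbedding) (planeEmb ρ.symm.toEmbedding)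
    (fun x => by
      rw [planeEmb_comp_apply]
      convert planeEmb_refl_apply x
      ext u
      simp)
    (fun x => by
      rw [planeEmb_comp_apply]
      convert planeEmb_refl_apply x
      ext u
      simp)

/-- Both `φ` and its inverse come from graph embeddings; these are mutually inverse because
`planeEmb` is injective and compatible with composition. -/
theorem exists_latIso (φ : Lat (freePlane Γ₁) ≃o Lat (freePlane Γ₂)) :
    ∃ ρ : Γ₁ ≃g Γ₂, φ = latIso ρ := by
  obtain ⟨f, hf⟩ := Lat.exists_emb
    (φ : BoundedLatticeHom (Lat (freePlane Γ₁)) (Lat (freePlane Γ₂))) φ.injective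
  obtain ⟨f', hf'⟩ := Lat.exists_emb
    (φ.symm : BoundedLatticeHom (Lat (freePlane Γ₂)) (Lat (freePlane Γ₁))) φ.symm.injective
  replace hf : ∀ x, φ x = Lat.map f x := hf
  replace hf' : ∀ x, φ.symm x = Lat.map f' x := hf'
  obtain ⟨ρ, rfl⟩ := f.exists_planeEmb
  obtain ⟨ρ', rfl⟩ := f'.exists_planeEmb
  have h1 : ρ'.comp ρ = SimpleGraph.Embedding.refl := planeEmb_injective <| by
    rw [← planeEmb_trans, planeEmb_refl]
    refine Emb.ext fun x => Lat.el.inj (Q := freePlane Γ₁) ?_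
    change Lat.map (planeEmb ρ') (Lat.map (planeEmb ρ) (Lat.el x)) = Lat.el x
    rw [← hf, ← hf', φ.symm_apply_apply]
  have h2 : ρ.comp ρ' = SimpleGraph.Embedding.refl := planeEmb_injective <| by
    rw [← planeEmb_trans, planeEmb_refl]
    refine Emb.ext fun x => Lat.el.inj (Q := freePlane Γ₂) ?_
    change Lat.map (planeEmb ρ) (Lat.map (planeEmb ρ') (Lat.el x)) = Lat.el x
    rw [← hf', ← hf, φ.apply_symm_apply]
  refine ⟨⟨⟨ρ, ρ', fun u => DFunLike.congr_fun h1 u, fun u => DFunLike.congr_fun h2 u⟩,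
    ρ.map_adj_iff⟩, ?_⟩
  ext x
  exact hf x

/-- Automorphisms of a graph correspond to automorphisms of the lattice of flats. -/
noncomputable def autEquiv (Γ : XGr) :
    (Γ ≃g Γ) ≃* (Lat (freePlane Γ) ≃o Lat (freePlane Γ)) :=
  MulEquiv.ofBijective
    (MonoidHom.mk' latIso fun ρ ρ' => by
      ext x
      change Lat.map _ x = Lat.map _ (Lat.map _ x)
      rw [← Lat.map_trans, planeEmb_trans]
      rfl)
    ⟨fun ρ ρ' h => by
      have : planeEmb ρ.toEmbedding = planeEmb ρ'.toEmbedding := Emb.ext fun x =>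
        Lat.el.inj (DFunLike.congr_fun h (Lat.el x) :)
      ext u
      exact DFunLike.congr_fun (planeEmb_injective this) u,
    fun φ => (exists_latIso φ).imp fun _ h => h.symm⟩

end Functor

end PartialPlane

open PartialPlane in
theorem theorem4p2 :
    ∃ P : XGr → XPpl, Measurable P ∧
      (∀ Γ₁ Γ₂ : XGr, Nonempty (Γ₁ ≃g Γ₂) ↔ Nonempty ((P Γ₁).Carrier ≃o (P Γ₂).Carrier)) ∧
      (∀ Γ : XGr, Nonempty ((Γ ≃g Γ) ≃* ((P Γ).Carrier ≃o (P Γ).Carrier))) ∧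
      (∀ Γ₁ Γ₂ : XGr, Nonempty (Γ₁ ↪g Γ₂) ↔ (P Γ₁).Embeds (P Γ₂)) := by
  refine ⟨codedPlane, measurable_codedPlane, fun Γ₁ Γ₂ => ⟨?_, ?_⟩, fun Γ => ?_,
    fun Γ₁ Γ₂ => embeds_iff⟩
  · rintro ⟨ρ⟩
    exact ⟨((carrierIso Γ₁).trans (latIso ρ)).trans (carrierIso Γ₂).symm⟩
  · rintro ⟨φ⟩
    exact ⟨(exists_latIso (((carrierIso Γ₁).symm.trans φ).trans (carrierIso Γ₂))).choose⟩
  · exact ⟨(autEquiv Γ).trans (OrderIso.conjAut (carrierIso Γ).symm)⟩
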